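/- Let $T\ge 1$ and $\mathcal T=\{1,\dots,T\}$. For each accident year $j\in\mathcal T$ let $(D_{j,k},Z_{j,k})_{k\ge1}$ be an i.i.d. sequence of pairs (development year, claim size) with values in $\mathcal T\times\mathbb R$, whose common law, that of a generic pair $(D,Z)$, does not depend on $j$ and satisfies $\operatorname{E}[Z^2]<\infty$ and $\operatorname{E}[Z\,I\{D=t\}]>0$ for every $t\in\mathcal T$. Let $\lambda_j\in(0,\infty)$, and let $(Y_{j,k})_{k\ge1}$ be i.i.d. nonnegative random variables with $\operatorname{E}[Y_{j,k}]=1/\lambda_j$ and $\operatorname{var}(Y_{j,k})<\infty$. For $\alpha\ge0$ let $M_j^\alpha=\sup\{m\ge1: \sum_{k=1}^m Y_{j,k}\le\alpha\}$ (with $\sup\emptyset=0$) be the corresponding renewal counting process. Suppose that, for each $\alpha\ge 0$, $M_j^\alpha$ is independent of $(D_{j,k},Z_{j,k})_{k\ge1}$ for each $j$, and that $\{M_j^\alpha,(D_{j,k},Z_{j,k})_{k\ge1}\}$, $j\in\mathcal T$, are independent across $j$. Put $$C^\alpha_{j,t}=\sum_{k=1}^{M_j^\alpha}Z_{j,k}\,I\{D_{j,k}\le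 t\}.$$ Fix $i\in\mathcal T$, put $t=T-i+1$ and write $\sigma_i^2=\operatorname{var}(Y_{i,1})$. Then $C^\alpha_{i,t}$ and $C^\alpha_{i,T}$ are integrable for every $\alpha\ge0$, and with $$H^\alpha=\alpha^{-1/2}\big(C^\alpha_{i,t}-\operatorname{E}[C^\alpha_{i,t}]\big),\qquad F^\alpha=\alpha^{-1/2}\big(C^\alpha_{i,T}-C^\alpha_{i,t}-\operatorname{E}[C^\alpha_{i,T}-C^\alpha_{i,t}]\big)$$ one has $(H^\alpha,F^\alpha)\to(H,F)$ in distribution as $\alpha\to\infty$, where $(H,F)$ is jointly (possibly degenerate) normal with mean zero and $$\operatorname{var}(H)=\lambda_i\operatorname{E}[Z^2I\{D\le t\}]+\lambda_i(\lambda_i^2\sigma_i^2-1)\operatorname{E}[Z\,I\{D\le t\}]^2,$$ $$\operatorname{var}(F)=\lambda_i\operatorname{E}[Z^2I\{D> t\}]+\lambda_i(\lambda_i^2\sigma_i^2-1)\operatorname{E}[Z\,I\{D> t\}]^2,$$ $$\operatorname{cov}(H,F)=\lambda_i(\lambda_i^2\sigma_i^2-1)\operatorname{E}[Z\,I\{D\le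 t\}]\operatorname{E}[Z\,I\{D> t\}].$$ -/

import Mathlib

open MeasureTheory ProbabilityTheory Filter

/-- The set `{1, …, T}` of accident years, which is also the set of development years. -/
abbrev Year (T : ℕ) : Type := Set.Icc 1 T

/-- `T_m = Y_1 + ⋯ + Y_m`. Sequences are indexed from `0`, so `Y_k` is `Y (k - 1)`. -/
def randomWalk {Ω : Type*} (Y : ℕ → Ω → ℝ) (m : ℕ) (ω : Ω) : ℝ :=
  ∑ k ∈ Finset.range m, Y k ω

/-- The counting process `M^α = sup {m ≥ 1 : T_m ≤ α}`; the supremum of the empty set is `0`.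
(For i.i.d. nonnegative steps with positive mean the set is almost surely finite.) -/
noncomputable def renewalCount {Ω : Type*} (Y : ℕ → Ω → ℝ) (α : ℝ) (ω : Ω) : ℕ :=
  sSup {m : ℕ | 1 ≤ m ∧ randomWalk Y m ω ≤ α}

/-- The amount `C^α_t = ∑_{k=1}^{M^α} Z_k I{D_k ≤ t}` of one accident year that is paid up to and
including development year `t`, where `M^α` is the renewal count with steps `Y`. -/
noncomputable def cumulativeClaims {Ω : Type*} {T : ℕ} (D : ℕ → Ω → Year T) (Z Y : ℕ → Ω → ℝ)
    (α : ℝ) (t : ℕ) (ω : Ω) : ℝ :=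
  ∑ k ∈ Finset.range (renewalCount Y α ω), if (D k ω : ℕ) ≤ t then Z k ω else 0

/-- The claims model over accident years `j ∈ {1, …, T}` in which the number of claims of year `j`
at exposure `α` is the renewal count of the steps `Y j 0, Y j 1, …`. The `k`-th claim of year `j`
has development year `D j k` and size `Z j k`. -/
structure RenewalClaimsModel {Ω : Type*} [MeasurableSpace Ω] (P : Measure Ω) (T : ℕ)
    (D : Year T → ℕ → Ω → Year T) (Z Y : Year T → ℕ → Ω → ℝ) (lam : Year T → ℝ) : Prop where
  measurable_D : ∀ j k, Measurable (D j k)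
  measurable_Z : ∀ j k, Measurable (Z j k)
  measurable_Y : ∀ j k, Measurable (Y j k)
  /-- within each accident year the pairs (development year, size) are independent -/
  claims_indep : ∀ j, iIndepFun (fun k ω => (D j k ω, Z j k ω)) P
  /-- the pairs have a common law, the same for all accident years -/
  claims_identDistrib : ∀ j k j' k',
    IdentDistrib (fun ω => (D j k ω, Z j k ω)) (fun ω => (D j' k' ω, Z j' k' ω)) P P
  /-- `E[Z²] < ∞` -/
  claims_sq : ∀ j k, MemLp (Z j k) 2 P
  /-- `E[Z I{D = t}] > 0` for each development year `t` -/
  claims_pos : ∀ j k, ∀ t : Year T, 0 < ∫ ω, (if D j k ω = t then Z j k ω else 0) ∂P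
  /-- the claims of a year are independent of its number of claims, at each exposure -/
  count_indep_claims : ∀ j, ∀ α : ℝ, 0 ≤ α →
    IndepFun (fun ω k => (D j k ω, Z j k ω)) (renewalCount (Y j) α) P
  /-- the accident years are independent, at each exposure -/
  years_indep : ∀ α : ℝ, 0 ≤ α →
    iIndepFun (fun j ω => (renewalCount (Y j) α ω, fun k => (D j k ω, Z j k ω))) P
  /-- the steps of each renewal process are i.i.d., nonnegative, of mean `1 / λ_j`, and of finite
  variance -/
  lam_pos : ∀ j, 0 < lam j
  steps_indep : ∀ j, iIndepFun (Y j) P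
  steps_identDistrib : ∀ j k k', IdentDistrib (Y j k) (Y j k') P P
  steps_nonneg : ∀ j k, ∀ᵐ ω ∂P, 0 ≤ Y j k ω
  steps_mean : ∀ j k, ∫ ω, Y j k ω ∂P = 1 / lam j
  steps_sq : ∀ j k, MemLp (Y j k) 2 P

/-!
The claims of one accident year form a renewal-stopped sum `S = ∑_{k < N} U_k`, where
`U_k = u Z_k I{D_k ≤ t} + v Z_k I{D_k > t}` for the linear combination of paid and outstanding
claims with coefficients `u` and `v`, and where `N` is the renewal count at exposure `α`. By
Lévy's theorem in the plane it suffices to find the limit of the characteristic function of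
`(S - E S) / √α` for all `u` and `v` (`tendstoInDistribution_prodMk_of_charFun`).

With `m = E U_0`, split `S - E S = ∑_{k < N} (U_k - m) + m (N - E N)`. Both parts are replaced, up
to an error that vanishes in `L¹` on the scale `√α`, by sums with the deterministic number
`n = ⌊α / μ⌋` of terms, where `μ` is the mean of the renewal steps `Y_k`.

* The tool is Wald's second identity in the form
  `E (∑_{k < ν} ξ_k - ∑_{k < n} ξ_k)² ≤ Var ξ_0 * E |ν - n|` for centred summands
  (`integral_sq_sum_range_random_sub_le`). It covers both a count that is independent of the
  summands and the first passage time `τ = N + 1` of the random walk `T` of the steps.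
* Pathwise, `μ τ = T_τ - ∑_{k < τ} (Y_k - μ)`, and the mean overshoot `E T_τ - α` is `o(√α)` because
  the steps have a finite second moment (`IsRenewalSteps.tendsto_overshoot`). With Wald's
  identities this yields `E |N - n| = o(α)` and
  `N - E N = -μ⁻¹ ∑_{k < n} (Y_k - μ) + o(√α)` in `L¹`
  (`IsRenewalSteps.tendsto_integral_abs_renewalCount_add`).

The sum `∑_{k < n} (U_k - m)` is independent of `N`, although it may depend on the steps. So the
characteristic function factorizes before `N - E N` is replaced by a sum of steps, and the classical
central limit theorem applies to each factor
(`IsRenewalSteps.tendsto_charFun_sum_range_renewalCount`). The limiting variance is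
`μ⁻¹ Var U_0 + μ⁻³ Var Y_0 m²`. As a quadratic form in `(u, v)` it is nonnegative, hence it is
that of the covariance matrix of a normal law.
-/

open scoped Topology

/-! ### Sums with a random number of terms -/

/-- Fatou's lemma for sequences that are bounded in `L¹`. -/
lemma integrable_and_integral_norm_le_of_tendsto {Ω : Type*} [MeasurableSpace Ω] {P : Measure Ω}
    {g : ℕ → Ω → ℝ} {G : Ω → ℝ} {B : ℝ} (hg : ∀ K, Integrable (g K) P)
    (hB : ∀ K, ∫ ω, ‖g K ω‖ ∂P ≤ B)
    (hlim : ∀ᵐ ω ∂P, Tendsto (fun K => g K ω) atTop (𝓝 (G ω))) :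
    Integrable G P ∧ ∫ ω, ‖G ω‖ ∂P ≤ B := by
  have hB0 : 0 ≤ B := (integral_nonneg fun _ => norm_nonneg _).trans (hB 0)
  have hGm : AEStronglyMeasurable G P :=
    aestronglyMeasurable_of_tendsto_ae atTop (fun K => (hg K).aestronglyMeasurable) hlim
  have h1 : eLpNorm G 1 P ≤ ENNReal.ofReal B := by
    refine (Lp.eLpNorm_lim_le_liminf_eLpNorm
      (fun K => (hg K).aestronglyMeasurable) G hlim).trans ?_
    refine liminf_le_of_le (by isBoundedDefault) fun b hb => ?_
    obtain ⟨K, hK⟩ := hb.exists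
    refine hK.trans ?_
    rw [eLpNorm_one_eq_lintegral_enorm, ← ofReal_integral_norm_eq_lintegral_enorm (hg K)]
    exact ENNReal.ofReal_le_ofReal (hB K)
  have hGi : Integrable G P :=
    memLp_one_iff_integrable.1 ⟨hGm, h1.trans_lt ENNReal.ofReal_lt_top⟩
  refine ⟨hGi, ?_⟩
  rw [eLpNorm_one_eq_lintegral_enorm, ← ofReal_integral_norm_eq_lintegral_enorm hGi] at h1
  exact (ENNReal.ofReal_le_ofReal_iff hB0).1 h1

lemma sum_range_ite_lt_eq_of_le {ν K : ℕ} (h : ν ≤ K) (x : ℕ → ℝ) :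
    ∑ k ∈ Finset.range K, (if k < ν then (1 : ℝ) else 0) * x k = ∑ k ∈ Finset.range ν, x k := by
  rw [← Finset.sum_subset (Finset.range_mono h)]
  · exact Finset.sum_congr rfl fun k hk => by simp [Finset.mem_range.1 hk]
  · intro k _ hk
    simp only [Finset.mem_range] at hk
    simp [hk]

lemma sum_range_ite_lt_le (ν K : ℕ) :
    ∑ k ∈ Finset.range K, (if k < ν then (1 : ℝ) else 0) ≤ ν := by
  have h := sum_range_ite_lt_eq_of_le (le_max_left ν K) (fun _ => 1)
  simp only [mul_one, Finset.sum_const, Finset.card_range, nsmul_eq_mul] at h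
  rw [← h]
  exact Finset.sum_le_sum_of_subset_of_nonneg (Finset.range_mono (le_max_right _ _))
    fun k _ _ => by split_ifs <;> norm_num

/-- The terms of a weighted sum of centred variables are orthogonal as soon as each variable is
independent of its weight and of the sum of the terms that precede it. -/
lemma integral_sq_sum_mul_eq {Ω : Type*} [MeasurableSpace Ω] {P : Measure Ω} {ξ e : ℕ → Ω → ℝ}
    {s2 : ℝ} (hξ2 : ∀ k, MemLp (ξ k) 2 P) (hξ0 : ∀ k, ∫ ω, ξ k ω ∂P = 0)
    (hξs : ∀ k, ∫ ω, ξ k ω ^ 2 ∂P = s2)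
    (hem : ∀ k, Measurable (e k)) (he1 : ∀ k ω, |e k ω| ≤ 1)
    (hind : ∀ K, IndepFun (fun ω => (e K ω, ∑ k ∈ Finset.range K, e k ω * ξ k ω)) (ξ K) P)
    (K : ℕ) :
    MemLp (fun ω => ∑ k ∈ Finset.range K, e k ω * ξ k ω) 2 P ∧
    ∫ ω, (∑ k ∈ Finset.range K, e k ω * ξ k ω) ^ 2 ∂P
      = s2 * ∑ k ∈ Finset.range K, ∫ ω, e k ω ^ 2 ∂P := by
  have heb : ∀ k, MemLp (e k) ⊤ P := fun k =>
    memLp_top_of_bound (hem k).aestronglyMeasurable 1 (ae_of_all _ fun ω => he1 k ω)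
  have heξ : ∀ k, MemLp (fun ω => e k ω * ξ k ω) 2 P := fun k => (hξ2 k).mul (heb k)
  have hS : ∀ K, MemLp (fun ω => ∑ k ∈ Finset.range K, e k ω * ξ k ω) 2 P := fun K =>
    memLp_finsetSum _ fun k _ => heξ k
  refine ⟨hS K, ?_⟩
  induction K with
  | zero => simp
  | succ K ih =>
    set S : Ω → ℝ := fun ω => ∑ k ∈ Finset.range K, e k ω * ξ k ω with hSdef
    have hexp : ∀ ω, (∑ k ∈ Finset.range (K + 1), e k ω * ξ k ω) ^ 2
        = S ω ^ 2 + 2 * ((e K ω * S ω) * ξ K ω) + e K ω ^ 2 * ξ K ω ^ 2 := fun ω => by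
      rw [Finset.sum_range_succ, hSdef]; ring
    have hSe : MemLp (fun ω => e K ω * S ω) 2 P := (hS K).mul (heb K)
    have hi1 : Integrable (fun ω => S ω ^ 2) P := (hS K).integrable_sq
    have hi2 : Integrable (fun ω => 2 * ((e K ω * S ω) * ξ K ω)) P :=
      (hSe.integrable_mul (hξ2 K)).const_mul 2
    have hi3 : Integrable (fun ω => e K ω ^ 2 * ξ K ω ^ 2) P := by
      simpa [mul_pow] using (heξ K).integrable_sq
    have hc : ∫ ω, (e K ω * S ω) * ξ K ω ∂P = 0 := by
      have h : IndepFun (fun ω => e K ω * S ω) (ξ K) P :=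
        (hind K).comp (φ := fun p : ℝ × ℝ => p.1 * p.2) (by fun_prop) measurable_id
      rw [h.integral_fun_mul_eq_mul_integral hSe.aestronglyMeasurable
        (hξ2 K).aestronglyMeasurable, hξ0, mul_zero]
    have hd : ∫ ω, e K ω ^ 2 * ξ K ω ^ 2 ∂P = s2 * ∫ ω, e K ω ^ 2 ∂P := by
      have h : IndepFun (fun ω => e K ω ^ 2) (fun ω => ξ K ω ^ 2) P :=
        (hind K).comp (φ := fun p : ℝ × ℝ => p.1 ^ 2) (ψ := fun x => x ^ 2) (by fun_prop)
          (by fun_prop)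
      rw [h.integral_fun_mul_eq_mul_integral ((hem K).pow_const 2).aestronglyMeasurable
        (hξ2 K).integrable_sq.aestronglyMeasurable, hξs, mul_comm]
    simp_rw [hexp]
    rw [integral_add (f := fun ω => S ω ^ 2 + 2 * (e K ω * S ω * ξ K ω)) (hi1.add hi2) hi3,
      integral_add hi1 hi2, integral_const_mul, hc, hd, ih,
      Finset.sum_range_succ]
    ring

section Wald

variable {Ω : Type*} [MeasurableSpace Ω] {P : Measure Ω} [IsProbabilityMeasure P]

lemma measurable_ite_lt {ν : Ω → ℕ} (hν : Measurable ν) (k : ℕ) :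
    Measurable fun ω => if k < ν ω then (1 : ℝ) else 0 :=
  (measurable_of_countable fun m : ℕ => if k < m then (1 : ℝ) else 0).comp hν

lemma integrable_ite_lt {ν : Ω → ℕ} (hν : Measurable ν) (k : ℕ) :
    Integrable (fun ω => if k < ν ω then (1 : ℝ) else 0) P :=
  Integrable.of_bound (measurable_ite_lt hν k).aestronglyMeasurable 1
    (ae_of_all _ fun ω => by split_ifs <;> simp)

lemma summable_integral_ite_lt {ν : Ω → ℕ} (hν : Measurable ν)
    (hνi : Integrable (fun ω => (ν ω : ℝ)) P) :
    Summable fun k => ∫ ω, (if k < ν ω then (1 : ℝ) else 0) ∂P := by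
  refine summable_of_sum_range_le (c := ∫ ω, (ν ω : ℝ) ∂P)
    (fun k => integral_nonneg fun ω => by dsimp only; split_ifs <;> norm_num) fun K => ?_
  rw [← integral_finsetSum _ fun k _ => integrable_ite_lt hν k]
  exact integral_mono (integrable_finsetSum _ fun k _ => integrable_ite_lt hν k) hνi
    fun ω => sum_range_ite_lt_le (ν ω) K

lemma integrable_ite_lt_mul_norm {ν : Ω → ℕ} (hν : Measurable ν) {g : Ω → ℝ} {k : ℕ}
    (hg : Integrable g P) (hind : IndepFun (fun ω => if k < ν ω then (1 : ℝ) else 0) g P) :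
    Integrable (fun ω => (if k < ν ω then (1 : ℝ) else 0) * ‖g ω‖) P :=
  (hind.comp measurable_id measurable_norm).integrable_mul (integrable_ite_lt hν k) hg.norm

lemma integral_ite_lt_mul_norm {ν : Ω → ℕ} (hν : Measurable ν) {f : ℕ → Ω → ℝ} {k : ℕ}
    (hf : IdentDistrib (f k) (f 0) P P) (hfi : Integrable (f k) P)
    (hind : IndepFun (fun ω => if k < ν ω then (1 : ℝ) else 0) (f k) P) :
    ∫ ω, (if k < ν ω then (1 : ℝ) else 0) * ‖f k ω‖ ∂P
      = (∫ ω, (if k < ν ω then (1 : ℝ) else 0) ∂P) * ∫ ω, ‖f 0 ω‖ ∂P := by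
  have h2 : IndepFun (fun ω => if k < ν ω then (1 : ℝ) else 0) (fun ω => ‖f k ω‖) P :=
    hind.comp measurable_id measurable_norm
  rw [h2.integral_fun_mul_eq_mul_integral (integrable_ite_lt hν k).aestronglyMeasurable
      hfi.norm.aestronglyMeasurable]
  congr 1
  exact (hf.comp measurable_norm).integral_eq

lemma hasSum_integral_ite_lt_mul {ν : Ω → ℕ} (hν : Measurable ν)
    (hνi : Integrable (fun ω => (ν ω : ℝ)) P) {f : ℕ → Ω → ℝ}
    (hf : ∀ k, IdentDistrib (f k) (f 0) P P) (hfi : Integrable (f 0) P)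
    (hind : ∀ k, IndepFun (fun ω => if k < ν ω then (1 : ℝ) else 0) (f k) P) :
    HasSum (fun k => (∫ ω, (if k < ν ω then (1 : ℝ) else 0) ∂P) * ∫ ω, f 0 ω ∂P)
      (∫ ω, ∑ k ∈ Finset.range (ν ω), f k ω ∂P) := by
  have hfki : ∀ k, Integrable (f k) P := fun k => (hf k).integrable_iff.2 hfi
  have key : ∀ k, Integrable (fun ω => (if k < ν ω then (1 : ℝ) else 0) * f k ω) P := fun k =>
    (hind k).integrable_mul (integrable_ite_lt hν k) (hfki k)
  have h := hasSum_integral_of_summable_integral_norm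
    (F := fun k ω => (if k < ν ω then (1 : ℝ) else 0) * f k ω) (μ := P) key ?_
  · have hsum : ∀ ω, ∑' k, (if k < ν ω then (1 : ℝ) else 0) * f k ω
        = ∑ k ∈ Finset.range (ν ω), f k ω := fun ω => by
      rw [tsum_eq_sum (s := Finset.range (ν ω)), sum_range_ite_lt_eq_of_le le_rfl]
      intro k hk
      simp only [Finset.mem_range] at hk
      simp [hk]
    simp_rw [hsum] at h
    convert! h using 1
    funext k
    rw [(hind k).integral_fun_mul_eq_mul_integral (integrable_ite_lt hν k).aestronglyMeasurable
      (hfki k).aestronglyMeasurable, (hf k).integral_eq]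
  · refine ((summable_integral_ite_lt hν hνi).mul_right (∫ ω, ‖f 0 ω‖ ∂P)).congr fun k => ?_
    have h1 : ∀ ω, ‖(if k < ν ω then (1 : ℝ) else 0) * f k ω‖
        = (if k < ν ω then (1 : ℝ) else 0) * ‖f k ω‖ := fun ω => by
      rw [norm_mul]; split_ifs <;> simp
    simp_rw [h1]
    exact (integral_ite_lt_mul_norm hν (hf k) (hfki k) (hind k)).symm

lemma tsum_integral_ite_lt {ν : Ω → ℕ} (hν : Measurable ν)
    (hνi : Integrable (fun ω => (ν ω : ℝ)) P) :
    ∑' k, ∫ ω, (if k < ν ω then (1 : ℝ) else 0) ∂P = ∫ ω, (ν ω : ℝ) ∂P := by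
  have h := hasSum_integral_ite_lt_mul hν hνi (f := fun _ _ => 1)
    (fun k => .refl aemeasurable_const) (integrable_const _) fun k => indepFun_const_right _ _
  simpa using h.tsum_eq

/-- **Wald's first identity.** The number of terms `ν` need not be independent of the summands:
it suffices that the decision to include the `k`-th summand is independent of it. -/
theorem integral_sum_range_random {ν : Ω → ℕ} (hν : Measurable ν)
    (hνi : Integrable (fun ω => (ν ω : ℝ)) P) {f : ℕ → Ω → ℝ}
    (hf : ∀ k, IdentDistrib (f k) (f 0) P P) (hfi : Integrable (f 0) P)
    (hind : ∀ k, IndepFun (fun ω => if k < ν ω then (1 : ℝ) else 0) (f k) P) :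
    ∫ ω, ∑ k ∈ Finset.range (ν ω), f k ω ∂P = (∫ ω, (ν ω : ℝ) ∂P) * ∫ ω, f 0 ω ∂P := by
  rw [← (hasSum_integral_ite_lt_mul hν hνi hf hfi hind).tsum_eq, tsum_mul_right,
    tsum_integral_ite_lt hν hνi]

theorem integrable_sum_range_random {ν : Ω → ℕ} (hν : Measurable ν)
    (hνi : Integrable (fun ω => (ν ω : ℝ)) P) {f : ℕ → Ω → ℝ}
    (hf : ∀ k, IdentDistrib (f k) (f 0) P P) (hfi : Integrable (f 0) P)
    (hind : ∀ k, IndepFun (fun ω => if k < ν ω then (1 : ℝ) else 0) (f k) P) :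
    Integrable (fun ω => ∑ k ∈ Finset.range (ν ω), f k ω) P := by
  have hfki : ∀ k, Integrable (f k) P := fun k => (hf k).integrable_iff.2 hfi
  have key : ∀ k, Integrable (fun ω => (if k < ν ω then (1 : ℝ) else 0) * f k ω) P := fun k =>
    (hind k).integrable_mul (integrable_ite_lt hν k) (hfki k)
  refine (integrable_and_integral_norm_le_of_tendsto
    (g := fun K ω => ∑ k ∈ Finset.range K, (if k < ν ω then (1 : ℝ) else 0) * f k ω)
    (B := (∫ ω, (ν ω : ℝ) ∂P) * ∫ ω, ‖f 0 ω‖ ∂P)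
    (fun K => integrable_finsetSum _ fun k _ => key k) (fun K => ?_) ?_).1
  · calc ∫ ω, ‖∑ k ∈ Finset.range K, (if k < ν ω then (1 : ℝ) else 0) * f k ω‖ ∂P
        ≤ ∫ ω, ∑ k ∈ Finset.range K, (if k < ν ω then (1 : ℝ) else 0) * ‖f k ω‖ ∂P := by
          refine integral_mono_of_nonneg (ae_of_all _ fun _ => norm_nonneg _)
            (integrable_finsetSum _ fun k _ => ?_) (ae_of_all _ fun ω => ?_)
          · exact integrable_ite_lt_mul_norm hν (hfki k) (hind k)
          · refine (norm_sum_le _ _).trans (Finset.sum_le_sum fun k _ => ?_)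
            rw [norm_mul]; split_ifs <;> simp
      _ = ∑ k ∈ Finset.range K,
            (∫ ω, (if k < ν ω then (1 : ℝ) else 0) ∂P) * ∫ ω, ‖f 0 ω‖ ∂P := by
          rw [integral_finsetSum _ fun k _ => integrable_ite_lt_mul_norm hν (hfki k) (hind k)]
          exact Finset.sum_congr rfl fun k _ =>
            integral_ite_lt_mul_norm hν (hf k) (hfki k) (hind k)
      _ ≤ _ := by
          rw [← Finset.sum_mul, ← tsum_integral_ite_lt hν hνi]
          refine mul_le_mul_of_nonneg_right ?_ (integral_nonneg fun _ => norm_nonneg _)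
          exact (summable_integral_ite_lt hν hνi).sum_le_tsum _ fun k _ =>
            integral_nonneg fun ω => by dsimp only; split_ifs <;> norm_num
  · refine ae_of_all _ fun ω => tendsto_const_nhds.congr' ?_
    filter_upwards [eventually_ge_atTop (ν ω)] with K hK
    exact (sum_range_ite_lt_eq_of_le hK _).symm

lemma sum_range_sq_ite_sub_ite_le (ν n K : ℕ) :
    ∑ k ∈ Finset.range K, ((if k < ν then (1 : ℝ) else 0) - (if k < n then (1 : ℝ) else 0)) ^ 2
      ≤ |(ν : ℝ) - n| := by
  wlog h : n ≤ ν generalizing ν n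
  · rw [abs_sub_comm]
    refine le_trans (le_of_eq ?_) (this n ν (by omega))
    exact Finset.sum_congr rfl fun k _ => by ring
  rw [abs_of_nonneg (by simpa using h)]
  have h1 : ∀ k, ((if k < ν then (1 : ℝ) else 0) - (if k < n then (1 : ℝ) else 0)) ^ 2
      = (if k < ν then (1 : ℝ) else 0) - (if k < n then (1 : ℝ) else 0) := fun k => by
    split_ifs <;> first | omega | norm_num
  have h2 : ∀ k, 0 ≤ (if k < ν then (1 : ℝ) else 0) - (if k < n then (1 : ℝ) else 0) := fun k => by
    split_ifs <;> first | omega | norm_num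
  simp_rw [h1]
  have h3 := sum_range_ite_lt_eq_of_le (le_max_left ν K) (fun _ => (1 : ℝ))
  have h4 := sum_range_ite_lt_eq_of_le (h.trans (le_max_left ν K)) (fun _ => (1 : ℝ))
  simp only [mul_one, Finset.sum_const, Finset.card_range, nsmul_eq_mul] at h3 h4
  calc _ ≤ ∑ k ∈ Finset.range (max ν K), ((if k < ν then (1 : ℝ) else 0)
        - (if k < n then (1 : ℝ) else 0)) :=
        Finset.sum_le_sum_of_subset_of_nonneg (Finset.range_mono (le_max_right _ _))
          fun k _ _ => h2 k
    _ = _ := by rw [Finset.sum_sub_distrib, h3, h4]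

/-- **Wald's second identity**, as an upper bound for the distance between a sum with a random and
a sum with a fixed number of centred terms. -/
theorem integral_sq_sum_range_random_sub_le {ν : Ω → ℕ} (hν : Measurable ν)
    (hνi : Integrable (fun ω => (ν ω : ℝ)) P) {ξ : ℕ → Ω → ℝ} {s2 : ℝ}
    (hξ2 : ∀ k, MemLp (ξ k) 2 P) (hξ0 : ∀ k, ∫ ω, ξ k ω ∂P = 0)
    (hξs : ∀ k, ∫ ω, ξ k ω ^ 2 ∂P = s2)
    (hind : ∀ K, IndepFun (fun ω => (min (ν ω) (K + 1), fun k : Finset.range K => ξ k ω)) (ξ K) P)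
    (n : ℕ) :
    MemLp (fun ω => ∑ k ∈ Finset.range (ν ω), ξ k ω - ∑ k ∈ Finset.range n, ξ k ω) 2 P ∧
    ∫ ω, (∑ k ∈ Finset.range (ν ω), ξ k ω - ∑ k ∈ Finset.range n, ξ k ω) ^ 2 ∂P
      ≤ s2 * ∫ ω, |(ν ω : ℝ) - n| ∂P := by
  -- the difference of the two sums is the series of the `ξ k` with weights `e k`
  set e : ℕ → Ω → ℝ := fun k ω =>
    (if k < ν ω then (1 : ℝ) else 0) - (if k < n then (1 : ℝ) else 0) with he
  have hem : ∀ k, Measurable (e k) := fun k => (measurable_ite_lt hν k).sub_const _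
  have he1 : ∀ k ω, |e k ω| ≤ 1 := fun k ω => by
    simp only [he]; split_ifs <;> norm_num
  have hs2 : 0 ≤ s2 := by
    rw [← hξs 0]; exact integral_nonneg fun _ => sq_nonneg _
  have hν' : Integrable (fun ω => |(ν ω : ℝ) - n|) P := (hνi.sub (integrable_const _)).abs
  have hindK : ∀ K, IndepFun (fun ω => (e K ω, ∑ k ∈ Finset.range K, e k ω * ξ k ω)) (ξ K) P := by
    intro K
    let w : ℕ → ℕ → ℝ := fun m k => (if k < m then (1 : ℝ) else 0) - (if k < n then (1 : ℝ) else 0)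
    let φ : ℕ × (Finset.range K → ℝ) → ℝ × ℝ := fun p =>
      (w p.1 K, ∑ k : Finset.range K, w p.1 k * p.2 k)
    have hφ : Measurable φ := by
      refine measurable_from_prod_countable_right fun m => ?_
      dsimp only [φ]
      fun_prop
    refine ((hind K).comp hφ measurable_id).congr (ae_of_all _ fun ω => ?_)
      (ae_of_all _ fun ω => rfl)
    have hw : ∀ k ≤ K, w (min (ν ω) (K + 1)) k = e k ω := fun k hk => by
      have : k < min (ν ω) (K + 1) ↔ k < ν ω := by omega
      simp only [w, he, this]
    simp only [φ, Function.comp_apply, Prod.mk.injEq]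
    refine ⟨hw K le_rfl, ?_⟩
    rw [← Finset.sum_coe_sort (Finset.range K) (fun k => e k ω * ξ k ω)]
    exact Finset.sum_congr rfl fun k _ => by rw [hw k (Finset.mem_range.1 k.2).le]
  have hK := integral_sq_sum_mul_eq hξ2 hξ0 hξs hem he1 hindK
  have hlim : ∀ ω, Tendsto (fun K => ∑ k ∈ Finset.range K, e k ω * ξ k ω) atTop
      (𝓝 (∑ k ∈ Finset.range (ν ω), ξ k ω - ∑ k ∈ Finset.range n, ξ k ω)) := fun ω => by
    refine tendsto_const_nhds.congr' ?_
    filter_upwards [eventually_ge_atTop (max (ν ω) n)] with K hK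
    simp only [he, sub_mul, Finset.sum_sub_distrib]
    rw [sum_range_ite_lt_eq_of_le ((le_max_left _ _).trans hK),
      sum_range_ite_lt_eq_of_le ((le_max_right _ _).trans hK)]
  have h := integrable_and_integral_norm_le_of_tendsto
    (g := fun K ω => (∑ k ∈ Finset.range K, e k ω * ξ k ω) ^ 2)
    (G := fun ω => (∑ k ∈ Finset.range (ν ω), ξ k ω - ∑ k ∈ Finset.range n, ξ k ω) ^ 2)
    (B := s2 * ∫ ω, |(ν ω : ℝ) - n| ∂P) (P := P)
    (fun K => (hK K).1.integrable_sq) (fun K => ?_) (ae_of_all _ fun ω => (hlim ω).pow 2)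
  · refine ⟨(memLp_two_iff_integrable_sq ?_).2 h.1, ?_⟩
    · exact aestronglyMeasurable_of_tendsto_ae atTop (fun K => (hK K).1.aestronglyMeasurable)
        (ae_of_all _ hlim)
    · simpa using h.2
  · simp only [norm_pow, Real.norm_eq_abs, sq_abs]
    rw [(hK K).2]
    refine mul_le_mul_of_nonneg_left ?_ hs2
    have hei : ∀ k, Integrable (fun ω => e k ω ^ 2) P := fun k =>
      Integrable.of_bound ((hem k).pow_const 2).aestronglyMeasurable 1 (ae_of_all _ fun ω => by
        rw [norm_pow, Real.norm_eq_abs]; exact pow_le_one₀ (abs_nonneg _) (he1 k ω))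
    rw [← integral_finsetSum _ fun k _ => hei k]
    exact integral_mono (integrable_finsetSum _ fun k _ => hei k) hν'
      fun ω => sum_range_sq_ite_sub_ite_le (ν ω) n K

end Wald

/-! ### Paths of the renewal counting process -/

/-- The count is measurable without any assumption on the signs of the steps: it takes the value
`n ≥ 1` if `n` is the last time at which the walk is at most `α`, and `0` on all other paths, also
on those where the supremum is over an unbounded set. -/
lemma measurable_renewalCount {Ω : Type*} [MeasurableSpace Ω] {Y : ℕ → Ω → ℝ}
    (hY : ∀ k, Measurable (Y k)) (α : ℝ) : Measurable (renewalCount Y α) := by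
  have hT : ∀ m, MeasurableSet {ω | randomWalk Y m ω ≤ α} := fun m =>
    measurableSet_le (Finset.measurable_fun_sum _ fun k _ => hY k) measurable_const
  have hpos : ∀ n, 1 ≤ n → MeasurableSet (renewalCount Y α ⁻¹' {n}) := by
    intro n hn
    have : renewalCount Y α ⁻¹' {n}
        = {ω | randomWalk Y n ω ≤ α} ∩ ⋂ m ∈ Set.Ioi n, {ω | randomWalk Y m ω ≤ α}ᶜ := by
      ext ω
      simp only [Set.mem_preimage, Set.mem_singleton_iff, Set.mem_inter_iff, Set.mem_ofPred_eq,
        Set.mem_iInter, Set.mem_Ioi, Set.mem_compl_iff]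
      constructor
      · intro h
        have hbdd : BddAbove {m : ℕ | 1 ≤ m ∧ randomWalk Y m ω ≤ α} := by
          by_contra hb
          have := Nat.sSup_of_not_bddAbove hb
          simp only [renewalCount] at h
          omega
        have hne : {m : ℕ | 1 ≤ m ∧ randomWalk Y m ω ≤ α}.Nonempty := by
          by_contra hb
          rw [Set.not_nonempty_iff_eq_empty] at hb
          simp only [renewalCount, hb, csSup_empty, Nat.bot_eq_zero] at h
          omega
        have hmem := Nat.sSup_mem hne hbdd
        change sSup _ = n at h
        rw [h] at hmem
        refine ⟨hmem.2, fun m hm hle => ?_⟩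
        have : m ≤ sSup {m : ℕ | 1 ≤ m ∧ randomWalk Y m ω ≤ α} :=
          le_csSup hbdd ⟨by omega, hle⟩
        omega
      · rintro ⟨h1, h2⟩
        refine IsGreatest.csSup_eq ⟨⟨hn, h1⟩, fun m hm => ?_⟩
        by_contra hlt
        exact h2 m (by omega) hm.2
    rw [this]
    exact (hT n).inter (.biInter (Set.to_countable _) fun m _ => (hT m).compl)
  refine measurable_to_countable' fun n => ?_
  rcases Nat.eq_zero_or_pos n with rfl | hn
  · have : renewalCount Y α ⁻¹' {0} = (⋃ m ∈ Set.Ici 1, renewalCount Y α ⁻¹' {m})ᶜ := by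
      ext ω
      simp only [Set.mem_preimage, Set.mem_singleton_iff, Set.mem_compl_iff, Set.mem_iUnion,
        Set.mem_Ici, exists_prop, not_exists, not_and]
      constructor
      · intro h m hm; omega
      · intro h
        by_contra h0
        exact h _ (Nat.one_le_iff_ne_zero.2 h0) rfl
    rw [this]
    exact (MeasurableSet.biUnion (Set.to_countable _) fun m hm => hpos m hm).compl
  · exact hpos n hn

/-- The index `renewalCount Y α + 1` is the first passage time of the random walk above `α`. -/
lemma lt_renewalCount_add_one_iff {Ω : Type*} {Y : ℕ → Ω → ℝ} {α : ℝ} {ω : Ω} (hα : 0 ≤ α)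
    (hY : ∀ k, 0 ≤ Y k ω) (hev : ∀ᶠ k in atTop, ¬ randomWalk Y k ω ≤ α) (k : ℕ) :
    k < renewalCount Y α ω + 1 ↔ randomWalk Y k ω ≤ α := by
  have hmono : Monotone fun k => randomWalk Y k ω := fun a b hab =>
    Finset.sum_le_sum_of_subset_of_nonneg (Finset.range_mono hab) fun k _ _ => hY k
  obtain ⟨b, hb⟩ := eventually_atTop.1 hev
  have hbdd : BddAbove {m : ℕ | 1 ≤ m ∧ randomWalk Y m ω ≤ α} :=
    ⟨b, fun m hm => by by_contra hlt; exact hb m (by omega) hm.2⟩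
  constructor
  · intro h
    rcases Set.eq_empty_or_nonempty {m : ℕ | 1 ≤ m ∧ randomWalk Y m ω ≤ α} with he | hne
    · simp only [renewalCount, he, csSup_empty, Nat.bot_eq_zero] at h
      obtain rfl : k = 0 := by omega
      simpa [randomWalk] using hα
    · exact (hmono (Nat.lt_succ_iff.1 h)).trans (Nat.sSup_mem hne hbdd).2
  · intro h
    rcases Nat.eq_zero_or_pos k with rfl | hk
    · omega
    · exact Nat.lt_succ_iff.2 (le_csSup hbdd ⟨hk, h⟩)

/-- A pathwise bound for the value of the walk at its first passage above `α`. The step that crosses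
the level is at most `R + g k`, and its excess `g k` over `R` is bounded by the sum of all `g k` up
to that time, which has a computable expectation. -/
lemma sum_ite_mul_le {y g : ℕ → ℝ} {α R : ℝ} (hα : 0 ≤ α) (hR : 0 ≤ R) (hg : ∀ k, 0 ≤ g k)
    (hyg : ∀ k, y k ≤ R + g k) (hy : ∀ k, 0 ≤ y k) (K : ℕ) :
    ∑ k ∈ Finset.range K, (if ∑ j ∈ Finset.range k, y j ≤ α then (1 : ℝ) else 0) * y k
      ≤ α + R
        + ∑ k ∈ Finset.range K, (if ∑ j ∈ Finset.range k, y j ≤ α then (1 : ℝ) else 0) * g k := by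
  induction K with
  | zero => simpa using add_nonneg hα hR
  | succ K ih =>
    by_cases h : ∑ j ∈ Finset.range K, y j ≤ α
    · have h1 : ∑ k ∈ Finset.range K, (if ∑ j ∈ Finset.range k, y j ≤ α then (1 : ℝ) else 0) * y k
          ≤ ∑ k ∈ Finset.range K, y k := Finset.sum_le_sum fun k _ => by
        split_ifs
        · simp
        · simpa using hy k
      have h2 : 0 ≤ ∑ k ∈ Finset.range K,
          (if ∑ j ∈ Finset.range k, y j ≤ α then (1 : ℝ) else 0) * g k :=
        Finset.sum_nonneg fun k _ => mul_nonneg (by split_ifs <;> norm_num) (hg k)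
      rw [Finset.sum_range_succ, Finset.sum_range_succ, if_pos h, one_mul, one_mul]
      linarith [hyg K]
    · rw [Finset.sum_range_succ, Finset.sum_range_succ, if_neg h]
      simpa using ih

/-- The square of a step that is larger than `R`, divided by `R`. -/
noncomputable def truncSq (R y : ℝ) : ℝ := (if R < y then y ^ 2 else 0) / R

lemma measurable_truncSq (R : ℝ) : Measurable (truncSq R) :=
  (Measurable.ite measurableSet_Ioi (by fun_prop) measurable_const).div_const R

lemma truncSq_nonneg {R : ℝ} (hR : 0 < R) (y : ℝ) : 0 ≤ truncSq R y := by
  unfold truncSq; split_ifs <;> positivity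

lemma truncSq_le {R : ℝ} (hR : 0 < R) (y : ℝ) : truncSq R y ≤ y ^ 2 / R := by
  unfold truncSq; split_ifs
  · exact le_rfl
  · rw [zero_div]; positivity

lemma le_add_truncSq {R : ℝ} (hR : 0 < R) (y : ℝ) : y ≤ R + truncSq R y := by
  unfold truncSq
  split_ifs with h
  · have : y ≤ y ^ 2 / R := by rw [le_div_iff₀ hR]; nlinarith
    linarith
  · simpa using h

/-! ### First-passage times of random walks with nonnegative steps -/

/-- The steps of a renewal process: independent, identically distributed, almost surely
nonnegative, with mean `μ > 0` and finite variance. -/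
structure IsRenewalSteps {Ω : Type*} [MeasurableSpace Ω] (P : Measure Ω) (Y : ℕ → Ω → ℝ)
    (μ : ℝ) : Prop where
  measurable : ∀ k, Measurable (Y k)
  indep : iIndepFun Y P
  identDistrib : ∀ k, IdentDistrib (Y k) (Y 0) P P
  nonneg : ∀ k, ∀ᵐ ω ∂P, 0 ≤ Y k ω
  memLp : MemLp (Y 0) 2 P
  mean : ∫ ω, Y 0 ω ∂P = μ
  mean_pos : 0 < μ

namespace IsRenewalSteps

variable {Ω : Type*} [MeasurableSpace Ω] {P : Measure Ω} {Y : ℕ → Ω → ℝ} {μ : ℝ}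

lemma measurable_randomWalk (hY : IsRenewalSteps P Y μ) (k : ℕ) : Measurable (randomWalk Y k) :=
  Finset.measurable_fun_sum _ fun k _ => hY.measurable k

lemma memLp_two (hY : IsRenewalSteps P Y μ) (k : ℕ) : MemLp (Y k) 2 P :=
  (hY.identDistrib k).memLp_iff.2 hY.memLp

/-- The past of the walk is independent of its next step. -/
lemma indepFun_past (hY : IsRenewalSteps P Y μ) (K : ℕ) :
    IndepFun (fun ω (k : Finset.range K) => Y k ω) (Y K) P := by
  have h := hY.indep.indepFun_finset (Finset.range K) {K} (by simp) hY.measurable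
  exact h.comp measurable_id
    (measurable_pi_apply (⟨K, Finset.mem_singleton_self K⟩ : ({K} : Finset ℕ)))

lemma indepFun_ite_randomWalk (hY : IsRenewalSteps P Y μ) (α : ℝ) (K : ℕ) :
    IndepFun (fun ω => if randomWalk Y K ω ≤ α then (1 : ℝ) else 0) (Y K) P := by
  have hφ : Measurable fun x : Finset.range K → ℝ => if ∑ k, x k ≤ α then (1 : ℝ) else 0 :=
    Measurable.ite (measurableSet_le (by fun_prop) measurable_const) measurable_const
      measurable_const
  refine ((hY.indepFun_past K).comp hφ measurable_id).congr (ae_of_all _ fun ω => ?_)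
    (ae_of_all _ fun ω => rfl)
  simp only [Function.comp_apply, randomWalk, Finset.sum_coe_sort (Finset.range K) fun k => Y k ω]
  rfl

lemma integrable_truncSq (hY : IsRenewalSteps P Y μ) {R : ℝ} (hR : 0 < R) (k : ℕ) :
    Integrable (fun ω => truncSq R (Y k ω)) P := by
  refine ((hY.memLp_two k).integrable_sq.div_const R).mono'
    ((measurable_truncSq R).comp (hY.measurable k)).aestronglyMeasurable (ae_of_all _ fun ω => ?_)
  rw [Real.norm_of_nonneg (truncSq_nonneg hR _)]
  exact truncSq_le hR _

variable [IsProbabilityMeasure P]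

lemma integrable_ite_randomWalk (hY : IsRenewalSteps P Y μ) (α : ℝ) (k : ℕ) :
    Integrable (fun ω => if randomWalk Y k ω ≤ α then (1 : ℝ) else 0) P :=
  Integrable.of_bound (Measurable.ite (measurableSet_le (hY.measurable_randomWalk k)
    measurable_const) measurable_const measurable_const).aestronglyMeasurable 1
    (ae_of_all _ fun ω => by split_ifs <;> simp)

lemma sum_integral_ite_randomWalk_le (hY : IsRenewalSteps P Y μ) {α R : ℝ} (hα : 0 ≤ α)
    (hR : 0 < R) (K : ℕ) :
    μ * ∑ k ∈ Finset.range K, ∫ ω, (if randomWalk Y k ω ≤ α then (1 : ℝ) else 0) ∂P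
      ≤ α + R + (∫ ω, truncSq R (Y 0 ω) ∂P)
        * ∑ k ∈ Finset.range K, ∫ ω, (if randomWalk Y k ω ≤ α then (1 : ℝ) else 0) ∂P := by
  have hYi : ∀ k, Integrable (Y k) P := fun k => (hY.memLp_two k).integrable (by norm_num)
  have hi1 : ∀ k, Integrable
      (fun ω => (if randomWalk Y k ω ≤ α then (1 : ℝ) else 0) * Y k ω) P := fun k =>
    (hY.indepFun_ite_randomWalk α k).integrable_mul (hY.integrable_ite_randomWalk α k) (hYi k)
  have hind2 : ∀ k, IndepFun (fun ω => if randomWalk Y k ω ≤ α then (1 : ℝ) else 0)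
      (fun ω => truncSq R (Y k ω)) P := fun k =>
    (hY.indepFun_ite_randomWalk α k).comp measurable_id (measurable_truncSq R)
  have hi2 : ∀ k, Integrable
      (fun ω => (if randomWalk Y k ω ≤ α then (1 : ℝ) else 0) * truncSq R (Y k ω)) P := fun k =>
    (hind2 k).integrable_mul (hY.integrable_ite_randomWalk α k) (hY.integrable_truncSq hR k)
  have e1 : ∀ k, ∫ ω, (if randomWalk Y k ω ≤ α then (1 : ℝ) else 0) * Y k ω ∂P
      = μ * ∫ ω, (if randomWalk Y k ω ≤ α then (1 : ℝ) else 0) ∂P := fun k => by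
    rw [(hY.indepFun_ite_randomWalk α k).integral_fun_mul_eq_mul_integral
      (hY.integrable_ite_randomWalk α k).aestronglyMeasurable (hYi k).aestronglyMeasurable,
      (hY.identDistrib k).integral_eq, hY.mean, mul_comm]
  have e2 : ∀ k, ∫ ω, (if randomWalk Y k ω ≤ α then (1 : ℝ) else 0) * truncSq R (Y k ω) ∂P
      = (∫ ω, truncSq R (Y 0 ω) ∂P)
        * ∫ ω, (if randomWalk Y k ω ≤ α then (1 : ℝ) else 0) ∂P := fun k => by
    rw [(hind2 k).integral_fun_mul_eq_mul_integral
      (hY.integrable_ite_randomWalk α k).aestronglyMeasurable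
      (hY.integrable_truncSq hR k).aestronglyMeasurable, mul_comm]
    congr 1
    exact ((hY.identDistrib k).comp (measurable_truncSq R)).integral_eq
  rw [Finset.mul_sum, Finset.mul_sum]
  simp_rw [← e1, ← e2]
  rw [← integral_finsetSum _ fun k _ => hi1 k, ← integral_finsetSum _ fun k _ => hi2 k]
  calc _ ≤ ∫ ω, ((α + R) + ∑ k ∈ Finset.range K,
        (if randomWalk Y k ω ≤ α then (1 : ℝ) else 0) * truncSq R (Y k ω)) ∂P := by
        refine integral_mono_ae (integrable_finsetSum _ fun k _ => hi1 k)
          ((integrable_const _).add (integrable_finsetSum _ fun k _ => hi2 k)) ?_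
        filter_upwards [ae_all_iff.2 hY.nonneg] with ω hω
        exact sum_ite_mul_le (y := fun k => Y k ω) (g := fun k => truncSq R (Y k ω)) hα hR.le
          (fun k => truncSq_nonneg hR _) (fun k => le_add_truncSq hR _) hω K
    _ = _ := by
        rw [integral_add (integrable_const _) (integrable_finsetSum _ fun k _ => hi2 k)]
        simp

/-- The mean first passage time grows at most linearly: the truncation level `R` is chosen so large
that the excess over `R` takes at most half of the drift `μ`. -/
lemma exists_sum_integral_ite_randomWalk_le (hY : IsRenewalSteps P Y μ) :
    ∃ C : ℝ, 0 < C ∧ ∀ α : ℝ, 0 ≤ α → ∀ K,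
      ∑ k ∈ Finset.range K, ∫ ω, (if randomWalk Y k ω ≤ α then (1 : ℝ) else 0) ∂P
        ≤ C * (1 + α) := by
  have hμ := hY.mean_pos
  set m2 : ℝ := ∫ ω, Y 0 ω ^ 2 ∂P with hm2
  have hm20 : 0 ≤ m2 := integral_nonneg fun _ => sq_nonneg _
  set R : ℝ := (2 * m2 + 1) / μ with hRdef
  have hR : 0 < R := by positivity
  have hδ : ∫ ω, truncSq R (Y 0 ω) ∂P ≤ μ / 2 := by
    calc _ ≤ ∫ ω, Y 0 ω ^ 2 / R ∂P :=
          integral_mono (hY.integrable_truncSq hR 0) (hY.memLp.integrable_sq.div_const R)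
            fun ω => truncSq_le hR _
      _ = m2 / R := integral_div _ _
      _ ≤ μ / 2 := by
          rw [div_le_div_iff₀ hR two_pos, hRdef, mul_div_cancel₀ _ hμ.ne']
          linarith
  refine ⟨2 * (1 + R) / μ, by positivity, fun α hα K => ?_⟩
  have h := hY.sum_integral_ite_randomWalk_le hα hR K
  set x := ∑ k ∈ Finset.range K, ∫ ω, (if randomWalk Y k ω ≤ α then (1 : ℝ) else 0) ∂P
  have hx : 0 ≤ x := Finset.sum_nonneg fun k _ => integral_nonneg fun ω => by
    dsimp only; split_ifs <;> norm_num
  have h2 : μ * x ≤ 2 * (α + R) := by nlinarith [mul_le_mul_of_nonneg_right hδ hx]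
  rw [div_mul_eq_mul_div, le_div_iff₀ hμ]
  nlinarith [mul_nonneg hR.le hα]

lemma ae_lt_renewalCount_add_one_iff (hY : IsRenewalSteps P Y μ) {α : ℝ} (hα : 0 ≤ α) :
    ∀ᵐ ω ∂P, ∀ k, k < renewalCount Y α ω + 1 ↔ randomWalk Y k ω ≤ α := by
  obtain ⟨C, -, hC⟩ := hY.exists_sum_integral_ite_randomWalk_le
  have hint : ∀ k, ∫ ω, (if randomWalk Y k ω ≤ α then (1 : ℝ) else 0) ∂P
      = P.real {ω | randomWalk Y k ω ≤ α} := fun k => by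
    rw [← integral_indicator_one (measurableSet_le (hY.measurable_randomWalk k) measurable_const)]
    exact integral_congr_ae (ae_of_all _ fun ω => by simp [Set.indicator_apply])
  have hsum : Summable fun k => P.real {ω | randomWalk Y k ω ≤ α} := by
    refine summable_of_sum_range_le (c := C * (1 + α)) (fun k => measureReal_nonneg) fun K => ?_
    simpa only [hint] using hC α hα K
  have hev : ∀ᵐ ω ∂P, ∀ᶠ k in atTop, ω ∉ {ω | randomWalk Y k ω ≤ α} := by
    refine ae_eventually_notMem ?_
    have := hsum.tsum_ofReal_ne_top
    simpa [measureReal_def] using this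
  filter_upwards [hev, ae_all_iff.2 hY.nonneg] with ω h1 h2
  exact lt_renewalCount_add_one_iff hα h2 h1

/-- The first passage time `renewalCount Y α + 1` is a stopping time: whether it exceeds `0, …, K`
is decided by the first `K` steps. -/
lemma indepFun_min_renewalCount (hY : IsRenewalSteps P Y μ) {α : ℝ} (hα : 0 ≤ α) (K : ℕ) :
    IndepFun (fun ω => (min (renewalCount Y α ω + 1) (K + 1), fun k : Finset.range K => Y k ω))
      (Y K) P := by
  let φ : (Finset.range K → ℝ) → ℕ × (Finset.range K → ℝ) := fun x =>
    (∑ j ∈ Finset.range (K + 1),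
      (if ∑ k : Finset.range K, (if (k : ℕ) < j then x k else 0) ≤ α then 1 else 0), x)
  have hφ : Measurable φ := by
    refine Measurable.prodMk (Finset.measurable_fun_sum _ fun j _ => ?_) measurable_id
    refine Measurable.ite (measurableSet_le (Finset.measurable_fun_sum _ fun k _ => ?_)
      measurable_const) measurable_const measurable_const
    split_ifs <;> fun_prop
  refine ((hY.indepFun_past K).comp hφ measurable_id).congr ?_ (ae_of_all _ fun ω => rfl)
  filter_upwards [hY.ae_lt_renewalCount_add_one_iff hα] with ω hω
  simp only [φ, Function.comp_apply, Prod.mk.injEq, and_true]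
  have hT : ∀ j ∈ Finset.range (K + 1),
      ∑ k : Finset.range K, (if (k : ℕ) < j then Y k ω else 0) = randomWalk Y j ω := by
    intro j hj
    rw [Finset.sum_coe_sort (Finset.range K) fun k => if k < j then Y k ω else 0,
      ← Finset.sum_filter, randomWalk]
    congr 1
    ext k
    simp only [Finset.mem_range, Finset.mem_filter] at hj ⊢
    omega
  rw [Finset.sum_congr rfl fun j hj => by rw [hT j hj]]
  simp_rw [← hω]
  rw [← Finset.sum_filter, Finset.sum_const, smul_eq_mul, mul_one,
    ← Finset.card_range (min (renewalCount Y α ω + 1) (K + 1))]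
  congr 1
  ext k
  simp only [Finset.mem_range, Finset.mem_filter]
  omega

lemma indepFun_ite_lt_renewalCount (hY : IsRenewalSteps P Y μ) {α : ℝ} (hα : 0 ≤ α) (k : ℕ) :
    IndepFun (fun ω => if k < renewalCount Y α ω + 1 then (1 : ℝ) else 0) (Y k) P := by
  refine (hY.indepFun_ite_randomWalk α k).congr ?_ ae_eq_rfl
  filter_upwards [hY.ae_lt_renewalCount_add_one_iff hα] with ω hω
  simp only [hω k]

lemma exists_integral_renewalCount_le (hY : IsRenewalSteps P Y μ) :
    ∃ C : ℝ, 0 < C ∧ ∀ α : ℝ, 0 ≤ α →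
      Integrable (fun ω => ((renewalCount Y α ω + 1 : ℕ) : ℝ)) P ∧
      ∫ ω, ((renewalCount Y α ω + 1 : ℕ) : ℝ) ∂P ≤ C * (1 + α) := by
  obtain ⟨C, hC0, hC⟩ := hY.exists_sum_integral_ite_randomWalk_le
  refine ⟨C, hC0, fun α hα => ?_⟩
  have h := integrable_and_integral_norm_le_of_tendsto (P := P)
    (g := fun K ω => ∑ k ∈ Finset.range K, (if randomWalk Y k ω ≤ α then (1 : ℝ) else 0))
    (G := fun ω => ((renewalCount Y α ω + 1 : ℕ) : ℝ)) (B := C * (1 + α))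
    (fun K => integrable_finsetSum _ fun k _ => hY.integrable_ite_randomWalk α k)
    (fun K => ?_) ?_
  · simpa only [Real.norm_natCast] using h
  · refine le_trans (le_of_eq ?_) (hC α hα K)
    rw [← integral_finsetSum _ fun k _ => hY.integrable_ite_randomWalk α k]
    refine integral_congr_ae (ae_of_all _ fun ω => Real.norm_of_nonneg ?_)
    exact Finset.sum_nonneg fun k _ => by split_ifs <;> norm_num
  · filter_upwards [hY.ae_lt_renewalCount_add_one_iff hα] with ω hω
    refine tendsto_const_nhds.congr' ?_
    filter_upwards [eventually_ge_atTop (renewalCount Y α ω + 1)] with K hK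
    have := sum_range_ite_lt_eq_of_le hK fun _ => (1 : ℝ)
    simp only [mul_one, Finset.sum_const, Finset.card_range, nsmul_eq_mul] at this
    simp_rw [← hω]
    exact this.symm

lemma integrable_renewalCount (hY : IsRenewalSteps P Y μ) {α : ℝ} (hα : 0 ≤ α) :
    Integrable (fun ω => (renewalCount Y α ω : ℝ)) P := by
  obtain ⟨C, -, hC⟩ := hY.exists_integral_renewalCount_le
  exact ((hC α hα).1.sub (integrable_const (1 : ℝ))).congr (ae_of_all _ fun ω => by simp)

lemma integrable_firstPassageValue (hY : IsRenewalSteps P Y μ) {α : ℝ} (hα : 0 ≤ α) :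
    Integrable (fun ω => randomWalk Y (renewalCount Y α ω + 1) ω) P := by
  obtain ⟨C, -, hC⟩ := hY.exists_integral_renewalCount_le
  exact integrable_sum_range_random ((measurable_renewalCount hY.measurable α).add_const 1)
    (hC α hα).1 hY.identDistrib (hY.memLp.integrable (by norm_num))
    (hY.indepFun_ite_lt_renewalCount hα)

lemma integral_firstPassageValue (hY : IsRenewalSteps P Y μ) {α : ℝ} (hα : 0 ≤ α) :
    ∫ ω, randomWalk Y (renewalCount Y α ω + 1) ω ∂P
      = (∫ ω, ((renewalCount Y α ω + 1 : ℕ) : ℝ) ∂P) * μ := by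
  obtain ⟨C, -, hC⟩ := hY.exists_integral_renewalCount_le
  rw [← hY.mean]
  exact integral_sum_range_random ((measurable_renewalCount hY.measurable α).add_const 1)
    (hC α hα).1 hY.identDistrib (hY.memLp.integrable (by norm_num))
    (hY.indepFun_ite_lt_renewalCount hα)

lemma ae_le_firstPassageValue (hY : IsRenewalSteps P Y μ) {α : ℝ} (hα : 0 ≤ α) :
    ∀ᵐ ω ∂P, α ≤ randomWalk Y (renewalCount Y α ω + 1) ω := by
  filter_upwards [hY.ae_lt_renewalCount_add_one_iff hα] with ω hω
  exact (not_le.1 ((hω _).not.1 (lt_irrefl _))).le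

lemma integral_firstPassageValue_le (hY : IsRenewalSteps P Y μ) {α R : ℝ} (hα : 0 ≤ α)
    (hR : 0 < R) :
    ∫ ω, randomWalk Y (renewalCount Y α ω + 1) ω ∂P
      ≤ α + R + (∫ ω, ((renewalCount Y α ω + 1 : ℕ) : ℝ) ∂P) * ∫ ω, truncSq R (Y 0 ω) ∂P := by
  obtain ⟨C, -, hC⟩ := hY.exists_integral_renewalCount_le
  have hind : ∀ k, IndepFun (fun ω => if k < renewalCount Y α ω + 1 then (1 : ℝ) else 0)
      (fun ω => truncSq R (Y k ω)) P := fun k =>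
    (hY.indepFun_ite_lt_renewalCount hα k).comp measurable_id (measurable_truncSq R)
  have hid : ∀ k, IdentDistrib (fun ω => truncSq R (Y k ω)) (fun ω => truncSq R (Y 0 ω)) P P :=
    fun k => (hY.identDistrib k).comp (measurable_truncSq R)
  have hτ := (measurable_renewalCount hY.measurable α).add_const 1
  have hgi := integrable_sum_range_random hτ (hC α hα).1 hid (hY.integrable_truncSq hR 0) hind
  rw [← integral_sum_range_random hτ (hC α hα).1 hid (hY.integrable_truncSq hR 0) hind]
  calc _ ≤ ∫ ω, ((α + R)
        + ∑ k ∈ Finset.range (renewalCount Y α ω + 1), truncSq R (Y k ω)) ∂P := by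
        refine integral_mono_ae (hY.integrable_firstPassageValue hα)
          ((integrable_const _).add hgi) ?_
        filter_upwards [ae_all_iff.2 hY.nonneg, hY.ae_lt_renewalCount_add_one_iff hα] with ω h0 hω
        have h := sum_ite_mul_le (y := fun k => Y k ω) (g := fun k => truncSq R (Y k ω)) hα hR.le
          (fun k => truncSq_nonneg hR _) (fun k => le_add_truncSq hR _) h0
          (renewalCount Y α ω + 1)
        simp only [randomWalk] at hω
        simp_rw [← hω] at h
        rwa [sum_range_ite_lt_eq_of_le le_rfl fun k => Y k ω,
          sum_range_ite_lt_eq_of_le le_rfl fun k => truncSq R (Y k ω)] at h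
    _ = _ := by
        rw [integral_add (integrable_const _) hgi]
        simp

end IsRenewalSteps

/-! ### First- and second-order asymptotics of the renewal count -/

lemma integral_abs_le_sqrt {Ω : Type*} [MeasurableSpace Ω] {P : Measure Ω}
    [IsProbabilityMeasure P] {X : Ω → ℝ} (hX : MemLp X 2 P) :
    ∫ ω, |X ω| ∂P ≤ √(∫ ω, X ω ^ 2 ∂P) := by
  refine Real.le_sqrt_of_sq_le ?_
  have h := variance_nonneg |X| P
  rw [variance_eq_sub hX.abs] at h
  simpa using h

/-- Errors whose second moment is `o(α)` are negligible in `L¹` on the scale `√α`. -/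
lemma tendsto_inv_sqrt_mul_integral_abs {Ω : Type*} [MeasurableSpace Ω] {P : Measure Ω}
    [IsProbabilityMeasure P] {X : ℝ → Ω → ℝ} (hX : ∀ α, 0 ≤ α → MemLp (X α) 2 P)
    (h : Tendsto (fun α => α⁻¹ * ∫ ω, X α ω ^ 2 ∂P) atTop (𝓝 0)) :
    Tendsto (fun α => (√α)⁻¹ * ∫ ω, |X α ω| ∂P) atTop (𝓝 0) := by
  have h2 := (Real.continuous_sqrt.tendsto 0).comp h
  rw [Real.sqrt_zero] at h2
  refine tendsto_of_tendsto_of_tendsto_of_le_of_le' tendsto_const_nhds h2 ?_ ?_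
  · exact Eventually.of_forall fun α => mul_nonneg (by positivity)
      (integral_nonneg fun _ => abs_nonneg _)
  · filter_upwards [eventually_ge_atTop 0] with α hα
    simp only [Function.comp_apply]
    rw [Real.sqrt_mul (by positivity), Real.sqrt_inv]
    exact mul_le_mul_of_nonneg_left (integral_abs_le_sqrt (hX α hα)) (by positivity)

lemma tendsto_integral_ite_lt_sq {Ω : Type*} [MeasurableSpace Ω] {P : Measure Ω} {X : Ω → ℝ}
    (hXm : Measurable X) (hX : MemLp X 2 P) :
    Tendsto (fun R : ℝ => ∫ ω, (if R < X ω then X ω ^ 2 else 0) ∂P) atTop (𝓝 0) := by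
  suffices h : Tendsto (fun R : ℝ => ∫ ω, (if R < X ω then X ω ^ 2 else 0) ∂P) atTop
      (𝓝 (∫ _, (0 : ℝ) ∂P)) by simpa using h
  refine tendsto_integral_filter_of_dominated_convergence (fun ω => X ω ^ 2)
    (Eventually.of_forall fun R => ?_) (Eventually.of_forall fun R => ae_of_all _ fun ω => ?_)
    hX.integrable_sq (ae_of_all _ fun ω => ?_)
  · exact (Measurable.ite (measurableSet_lt measurable_const hXm) (hXm.pow_const 2)
      measurable_const).aestronglyMeasurable
  · split_ifs
    · simp
    · simpa using sq_nonneg (X ω)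
  · refine tendsto_const_nhds.congr' ?_
    filter_upwards [eventually_ge_atTop (X ω)] with R hR
    rw [if_neg (not_lt.2 hR)]

namespace IsRenewalSteps

variable {Ω : Type*} [MeasurableSpace Ω] {P : Measure Ω} {Y : ℕ → Ω → ℝ} {μ : ℝ}

lemma integral_step_sub_sq (hY : IsRenewalSteps P Y μ) (k : ℕ) :
    ∫ ω, (Y k ω - μ) ^ 2 ∂P = Var[Y 0; P] := by
  have h := variance_eq_integral (hY.measurable k).aemeasurable (μ := P)
  rw [(hY.identDistrib k).integral_eq, hY.mean, (hY.identDistrib k).variance_eq] at h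
  exact h.symm

/-- The path identity behind the renewal theorems: `μ τ = T_τ - ∑_{k < τ} (Y_k - μ)`. -/
lemma firstPassage_eq (hY : IsRenewalSteps P Y μ) (α : ℝ) (ω : Ω) :
    ((renewalCount Y α ω + 1 : ℕ) : ℝ) = μ⁻¹ * (randomWalk Y (renewalCount Y α ω + 1) ω
      - ∑ k ∈ Finset.range (renewalCount Y α ω + 1), (Y k ω - μ)) := by
  rw [Finset.sum_sub_distrib, Finset.sum_const, Finset.card_range, nsmul_eq_mul, randomWalk,
    sub_sub_cancel, mul_comm, mul_assoc, mul_inv_cancel₀ hY.mean_pos.ne', mul_one]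

variable [IsProbabilityMeasure P]

/-- The mean overshoot of the walk over the level `α` is `o(√α)`: a finite second moment of the
steps makes steps of size `ε √α` negligible among the first `O(α)` ones. -/
lemma tendsto_overshoot (hY : IsRenewalSteps P Y μ) :
    Tendsto (fun α => (√α)⁻¹ * (∫ ω, randomWalk Y (renewalCount Y α ω + 1) ω ∂P - α)) atTop
      (𝓝 0) := by
  obtain ⟨C, hC0, hC⟩ := hY.exists_integral_renewalCount_le
  have hlow : ∀ α, 0 ≤ α → 0 ≤ ∫ ω, randomWalk Y (renewalCount Y α ω + 1) ω ∂P - α := by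
    intro α hα
    have h := integral_mono_ae (integrable_const α) (hY.integrable_firstPassageValue hα)
      (hY.ae_le_firstPassageValue hα)
    simp only [integral_const, probReal_univ, one_smul] at h
    linarith
  rw [Metric.tendsto_nhds]
  intro ε hε
  have hδ : Tendsto (fun α : ℝ => 2 * C / (ε / 2)
      * ∫ ω, (if ε / 2 * √α < Y 0 ω then Y 0 ω ^ 2 else 0) ∂P) atTop (𝓝 0) := by
    have h := (tendsto_integral_ite_lt_sq (hY.measurable 0) hY.memLp).comp
      (Real.tendsto_sqrt_atTop.const_mul_atTop (half_pos hε))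
    simpa using h.const_mul (2 * C / (ε / 2))
  filter_upwards [eventually_ge_atTop 1, hδ.eventually_lt_const (half_pos hε)] with α hα hα2
  have hα0 : 0 < α := by linarith
  have hs : 0 < √α := Real.sqrt_pos.2 hα0
  have hss : √α * √α = α := Real.mul_self_sqrt hα0.le
  rw [Real.dist_eq, sub_zero, abs_of_nonneg (mul_nonneg (by positivity) (hlow α hα0.le))]
  have hR : 0 < ε / 2 * √α := by positivity
  have h1 := hY.integral_firstPassageValue_le hα0.le hR
  have h2 := (hC α hα0.le).2
  set δ := ∫ ω, (if ε / 2 * √α < Y 0 ω then Y 0 ω ^ 2 else 0) ∂P with hδdef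
  have hδ0 : 0 ≤ δ := integral_nonneg fun ω => by dsimp only; split_ifs <;> positivity
  have h3 : ∫ ω, truncSq (ε / 2 * √α) (Y 0 ω) ∂P = δ / (ε / 2 * √α) := by
    simp only [truncSq]
    rw [integral_div]
  rw [h3] at h1
  have h4 : (∫ ω, ((renewalCount Y α ω + 1 : ℕ) : ℝ) ∂P) * (δ / (ε / 2 * √α))
      ≤ 2 * C * α * (δ / (ε / 2 * √α)) :=
    mul_le_mul_of_nonneg_right (by nlinarith) (by positivity)
  have h5 : 2 * C * α * (δ / (ε / 2 * √α)) = √α * (2 * C / (ε / 2) * δ) := by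
    calc _ = α / √α * (2 * C / (ε / 2) * δ) := by field_simp
      _ = _ := by rw [Real.div_sqrt]
  rw [inv_mul_lt_iff₀ hs]
  nlinarith

lemma memLp_step_sub (hY : IsRenewalSteps P Y μ) (k : ℕ) : MemLp (fun ω => Y k ω - μ) 2 P :=
  (hY.memLp_two k).sub (memLp_const μ)

lemma integral_step_sub (hY : IsRenewalSteps P Y μ) (k : ℕ) : ∫ ω, (Y k ω - μ) ∂P = 0 := by
  rw [integral_sub ((hY.memLp_two k).integrable (by norm_num)) (integrable_const _),
    (hY.identDistrib k).integral_eq, hY.mean]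
  simp

lemma sq_firstPassage_sub_le (hY : IsRenewalSteps P Y μ) {α : ℝ} (hα : 0 ≤ α) (n : ℕ) :
    MemLp (fun ω => ∑ k ∈ Finset.range (renewalCount Y α ω + 1), (Y k ω - μ)
      - ∑ k ∈ Finset.range n, (Y k ω - μ)) 2 P ∧
    ∫ ω, (∑ k ∈ Finset.range (renewalCount Y α ω + 1), (Y k ω - μ)
      - ∑ k ∈ Finset.range n, (Y k ω - μ)) ^ 2 ∂P
      ≤ Var[Y 0; P] * ∫ ω, |((renewalCount Y α ω + 1 : ℕ) : ℝ) - n| ∂P := by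
  obtain ⟨C, -, hC⟩ := hY.exists_integral_renewalCount_le
  refine integral_sq_sum_range_random_sub_le
    ((measurable_renewalCount hY.measurable α).add_const 1) (hC α hα).1
    (ξ := fun k ω => Y k ω - μ) hY.memLp_step_sub hY.integral_step_sub hY.integral_step_sub_sq
    (fun K => ?_) n
  exact (hY.indepFun_min_renewalCount hα K).comp
    (φ := fun p : ℕ × (Finset.range K → ℝ) => (p.1, fun k => p.2 k - μ)) (ψ := fun x => x - μ)
    (by fun_prop) (by fun_prop)

lemma integral_overshoot_eq (hY : IsRenewalSteps P Y μ) {α : ℝ} (hα : 0 ≤ α) :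
    ∫ ω, |randomWalk Y (renewalCount Y α ω + 1) ω - α| ∂P
      = ∫ ω, randomWalk Y (renewalCount Y α ω + 1) ω ∂P - α := by
  have h : ∫ ω, |randomWalk Y (renewalCount Y α ω + 1) ω - α| ∂P
      = ∫ ω, (randomWalk Y (renewalCount Y α ω + 1) ω - α) ∂P := by
    refine integral_congr_ae ?_
    filter_upwards [hY.ae_le_firstPassageValue hα] with ω hω
    exact abs_of_nonneg (by linarith)
  rw [h, integral_sub (hY.integrable_firstPassageValue hα) (integrable_const _)]
  simp

/-- The first passage time is within `o(α)` of `α / μ` in `L¹`. -/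
lemma tendsto_integral_abs_firstPassage_sub (hY : IsRenewalSteps P Y μ) :
    Tendsto (fun α => α⁻¹ * ∫ ω, |((renewalCount Y α ω + 1 : ℕ) : ℝ) - ⌊α / μ⌋₊| ∂P) atTop
      (𝓝 0) := by
  obtain ⟨C, hC0, hC⟩ := hY.exists_integral_renewalCount_le
  have hμ := hY.mean_pos
  set V := Var[Y 0; P] with hV
  have hV0 : 0 ≤ V := variance_nonneg _ _
  have hsqrt : Tendsto (fun α : ℝ => (√α)⁻¹) atTop (𝓝 0) :=
    tendsto_inv_atTop_zero.comp Real.tendsto_sqrt_atTop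
  have hinv : Tendsto (fun α : ℝ => α⁻¹) atTop (𝓝 0) := tendsto_inv_atTop_zero
  have hlim : Tendsto (fun α => μ⁻¹ * ((√α)⁻¹ * ((√α)⁻¹ *
      (∫ ω, randomWalk Y (renewalCount Y α ω + 1) ω ∂P - α)) + (1 + V * C * 2) * (√α)⁻¹) + α⁻¹)
      atTop (𝓝 0) := by
    have := (((hsqrt.mul hY.tendsto_overshoot).add (hsqrt.const_mul (1 + V * C * 2))).const_mul
      μ⁻¹).add hinv
    simpa using this
  refine tendsto_of_tendsto_of_tendsto_of_le_of_le' tendsto_const_nhds hlim ?_ ?_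
  · filter_upwards [eventually_ge_atTop 0] with α hα
    exact mul_nonneg (by positivity) (integral_nonneg fun _ => abs_nonneg _)
  filter_upwards [eventually_ge_atTop 1] with α hα
  have hα0 : 0 < α := by linarith
  have hs : 0 < √α := Real.sqrt_pos.2 hα0
  have hss : √α * √α = α := Real.mul_self_sqrt hα0.le
  set M : Ω → ℝ := fun ω => ∑ k ∈ Finset.range (renewalCount Y α ω + 1), (Y k ω - μ) with hM
  have hM2 := hY.sq_firstPassage_sub_le hα0.le 0
  simp only [Finset.range_zero, Finset.sum_empty, sub_zero, Nat.cast_zero, Nat.abs_cast] at hM2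
  have hMi : Integrable (fun ω => M ω ^ 2) P := hM2.1.integrable_sq
  have hoi : Integrable (fun ω => |randomWalk Y (renewalCount Y α ω + 1) ω - α|) P :=
    ((hY.integrable_firstPassageValue hα0.le).sub (integrable_const α)).abs
  have hpt : ∀ ω, |((renewalCount Y α ω + 1 : ℕ) : ℝ) - ⌊α / μ⌋₊|
      ≤ μ⁻¹ * (|randomWalk Y (renewalCount Y α ω + 1) ω - α| + (√α + (√α)⁻¹ * M ω ^ 2)) + 1 := by
    intro ω
    have hfl1 : (⌊α / μ⌋₊ : ℝ) ≤ α / μ := Nat.floor_le (by positivity)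
    have hfl2 : α / μ < ⌊α / μ⌋₊ + 1 := Nat.lt_floor_add_one _
    have heq : ((renewalCount Y α ω + 1 : ℕ) : ℝ) - ⌊α / μ⌋₊
        = μ⁻¹ * ((randomWalk Y (renewalCount Y α ω + 1) ω - α) - M ω) + (α / μ - ⌊α / μ⌋₊) := by
      rw [hY.firstPassage_eq α ω, hM]; ring
    -- the inequality between arithmetic and geometric means, on the scale of `M`, that is `√α`
    have hMb : |M ω| ≤ √α + (√α)⁻¹ * M ω ^ 2 := by
      rw [← sub_nonneg, ← mul_nonneg_iff_of_pos_left hs]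
      have : √α * (√α + (√α)⁻¹ * M ω ^ 2 - |M ω|) = √α ^ 2 - √α * |M ω| + |M ω| ^ 2 := by
        rw [sq_abs]; field_simp; ring
      rw [this]
      nlinarith [sq_nonneg (√α - |M ω|), sq_nonneg (√α), sq_nonneg (|M ω|)]
    rw [heq]
    refine (abs_add_le _ _).trans (add_le_add ?_ ?_)
    · rw [abs_mul, abs_of_pos (inv_pos.2 hμ)]
      exact mul_le_mul_of_nonneg_left ((abs_sub _ _).trans (by gcongr)) (by positivity)
    · rw [abs_of_nonneg] <;> linarith
  have hint : ∫ ω, |((renewalCount Y α ω + 1 : ℕ) : ℝ) - ⌊α / μ⌋₊| ∂P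
      ≤ μ⁻¹ * ((∫ ω, randomWalk Y (renewalCount Y α ω + 1) ω ∂P - α)
        + (√α + (√α)⁻¹ * (V * (C * (1 + α))))) + 1 := by
    have hMi' : Integrable (fun ω => √α + (√α)⁻¹ * M ω ^ 2) P :=
      (integrable_const _).add (hMi.const_mul _)
    have hsum : Integrable (fun ω => |randomWalk Y (renewalCount Y α ω + 1) ω - α|
        + (√α + (√α)⁻¹ * M ω ^ 2)) P := hoi.add hMi'
    calc _ ≤ ∫ ω, (μ⁻¹ * (|randomWalk Y (renewalCount Y α ω + 1) ω - α|
          + (√α + (√α)⁻¹ * M ω ^ 2)) + 1) ∂P :=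
          integral_mono_of_nonneg (ae_of_all _ fun _ => abs_nonneg _)
            ((hsum.const_mul _).add (integrable_const _)) (ae_of_all _ hpt)
      _ = μ⁻¹ * ((∫ ω, randomWalk Y (renewalCount Y α ω + 1) ω ∂P - α)
        + (√α + (√α)⁻¹ * ∫ ω, M ω ^ 2 ∂P)) + 1 := by
          rw [integral_add (hsum.const_mul _) (integrable_const _), integral_const_mul,
            integral_add hoi hMi', hY.integral_overshoot_eq hα0.le,
            integral_add (integrable_const _) (hMi.const_mul _), integral_const_mul]
          simp
      _ ≤ _ := by
          gcongr
          exact hM2.2.trans (mul_le_mul_of_nonneg_left (hC α hα0.le).2 hV0)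
  refine (mul_le_mul_of_nonneg_left hint (by positivity)).trans ?_
  have hlast : (√α)⁻¹ * (V * (C * (1 + α))) ≤ (√α)⁻¹ * (V * (C * (2 * α))) := by
    gcongr; linarith
  have hlast2 : (√α)⁻¹ * (V * (C * (2 * α))) = V * C * 2 * √α := by
    calc _ = V * C * 2 * (α / √α) := by field_simp
      _ = _ := by rw [Real.div_sqrt]
  calc _ ≤ α⁻¹ * (μ⁻¹ * ((∫ ω, randomWalk Y (renewalCount Y α ω + 1) ω ∂P - α)
        + (√α + V * C * 2 * √α)) + 1) := by
        rw [← hlast2]; gcongr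
    _ = _ := by
        have hi : α⁻¹ = (√α)⁻¹ * (√α)⁻¹ := by rw [← mul_inv, hss]
        rw [hi]; field_simp

/-- Linearization of the centred renewal count: on the scale `√α` it is the centred random walk
at the deterministic time `α / μ`, multiplied by `-1 / μ`. -/
lemma tendsto_integral_abs_renewalCount_add (hY : IsRenewalSteps P Y μ) :
    Tendsto (fun α => (√α)⁻¹ * ∫ ω, |((renewalCount Y α ω : ℝ)
      - ∫ ω', (renewalCount Y α ω' : ℝ) ∂P)
        + μ⁻¹ * ∑ k ∈ Finset.range ⌊α / μ⌋₊, (Y k ω - μ)| ∂P) atTop (𝓝 0) := by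
  obtain ⟨C, hC0, hC⟩ := hY.exists_integral_renewalCount_le
  have hμ := hY.mean_pos
  have hX := tendsto_inv_sqrt_mul_integral_abs
    (X := fun α ω => ∑ k ∈ Finset.range (renewalCount Y α ω + 1), (Y k ω - μ)
      - ∑ k ∈ Finset.range ⌊α / μ⌋₊, (Y k ω - μ)) (P := P)
    (fun α hα => (hY.sq_firstPassage_sub_le hα ⌊α / μ⌋₊).1) ?_
  · have hlim : Tendsto (fun α => μ⁻¹ * (2 * ((√α)⁻¹ *
        (∫ ω, randomWalk Y (renewalCount Y α ω + 1) ω ∂P - α)) + (√α)⁻¹ *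
        ∫ ω, |∑ k ∈ Finset.range (renewalCount Y α ω + 1), (Y k ω - μ)
          - ∑ k ∈ Finset.range ⌊α / μ⌋₊, (Y k ω - μ)| ∂P)) atTop (𝓝 0) := by
      simpa using ((hY.tendsto_overshoot.const_mul 2).add hX).const_mul μ⁻¹
    refine tendsto_of_tendsto_of_tendsto_of_le_of_le' tendsto_const_nhds hlim ?_ ?_
    · exact Eventually.of_forall fun α => mul_nonneg (by positivity)
        (integral_nonneg fun _ => abs_nonneg _)
    filter_upwards [eventually_ge_atTop 0] with α hα
    set X : Ω → ℝ := fun ω => ∑ k ∈ Finset.range (renewalCount Y α ω + 1), (Y k ω - μ)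
      - ∑ k ∈ Finset.range ⌊α / μ⌋₊, (Y k ω - μ) with hXdef
    set o : ℝ := ∫ ω, randomWalk Y (renewalCount Y α ω + 1) ω ∂P - α with ho
    have ho0 : 0 ≤ o := by
      rw [ho, ← hY.integral_overshoot_eq hα]
      exact integral_nonneg fun _ => abs_nonneg _
    have hXi : Integrable X P := (hY.sq_firstPassage_sub_le hα ⌊α / μ⌋₊).1.integrable (by norm_num)
    have hoi : Integrable (fun ω => |randomWalk Y (renewalCount Y α ω + 1) ω - α|) P :=
      ((hY.integrable_firstPassageValue hα).sub (integrable_const α)).abs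
    have hE : ∫ ω, (renewalCount Y α ω : ℝ) ∂P = μ⁻¹ * (o + α) - 1 := by
      have h1 := hY.integral_firstPassageValue hα
      have h2 : ∫ ω, ((renewalCount Y α ω + 1 : ℕ) : ℝ) ∂P
          = ∫ ω, (renewalCount Y α ω : ℝ) ∂P + 1 := by
        simp only [Nat.cast_add, Nat.cast_one]
        rw [integral_add (hY.integrable_renewalCount hα) (integrable_const _)]
        simp
      rw [ho, sub_add_cancel, h1, h2]
      field_simp
      ring
    have hpt : ∀ ω, |((renewalCount Y α ω : ℝ) - ∫ ω', (renewalCount Y α ω' : ℝ) ∂P)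
        + μ⁻¹ * ∑ k ∈ Finset.range ⌊α / μ⌋₊, (Y k ω - μ)|
        ≤ μ⁻¹ * (|randomWalk Y (renewalCount Y α ω + 1) ω - α| + (o + |X ω|)) := by
      intro ω
      have heq : ((renewalCount Y α ω : ℝ) - ∫ ω', (renewalCount Y α ω' : ℝ) ∂P)
          + μ⁻¹ * ∑ k ∈ Finset.range ⌊α / μ⌋₊, (Y k ω - μ)
          = μ⁻¹ * ((randomWalk Y (renewalCount Y α ω + 1) ω - α) - (o + X ω)) := by
        have h1 := hY.firstPassage_eq α ω
        rw [Nat.cast_add, Nat.cast_one] at h1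
        rw [hE, eq_sub_of_add_eq h1, hXdef]
        ring
      rw [heq, abs_mul, abs_of_pos (inv_pos.2 hμ)]
      refine mul_le_mul_of_nonneg_left ((abs_sub _ _).trans ?_) (by positivity)
      gcongr
      exact (abs_add_le _ _).trans (by rw [abs_of_nonneg ho0])
    have hint : ∫ ω, |((renewalCount Y α ω : ℝ) - ∫ ω', (renewalCount Y α ω' : ℝ) ∂P)
        + μ⁻¹ * ∑ k ∈ Finset.range ⌊α / μ⌋₊, (Y k ω - μ)| ∂P
        ≤ μ⁻¹ * (2 * o + ∫ ω, |X ω| ∂P) := by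
      have hXi' : Integrable (fun ω => o + |X ω|) P := (integrable_const _).add hXi.abs
      calc _ ≤ ∫ ω, μ⁻¹ * (|randomWalk Y (renewalCount Y α ω + 1) ω - α| + (o + |X ω|)) ∂P :=
            integral_mono_of_nonneg (ae_of_all _ fun _ => abs_nonneg _)
              ((hoi.add hXi').const_mul _) (ae_of_all _ hpt)
        _ = _ := by
            rw [integral_const_mul, integral_add hoi hXi', hY.integral_overshoot_eq hα,
              integral_add (integrable_const _) hXi.abs]
            simp only [integral_const, probReal_univ, one_smul]
            ring
    calc _ ≤ (√α)⁻¹ * (μ⁻¹ * (2 * o + ∫ ω, |X ω| ∂P)) :=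
          mul_le_mul_of_nonneg_left hint (by positivity)
      _ = _ := by ring
  · have hlim := (hY.tendsto_integral_abs_firstPassage_sub).const_mul (Var[Y 0; P])
    rw [mul_zero] at hlim
    refine tendsto_of_tendsto_of_tendsto_of_le_of_le' tendsto_const_nhds hlim ?_ ?_
    · filter_upwards [eventually_ge_atTop 0] with α hα
      exact mul_nonneg (by positivity) (integral_nonneg fun _ => sq_nonneg _)
    · filter_upwards [eventually_ge_atTop 0] with α hα
      refine (mul_le_mul_of_nonneg_left (hY.sq_firstPassage_sub_le hα ⌊α / μ⌋₊).2
        (by positivity)).trans (le_of_eq ?_)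
      ring

end IsRenewalSteps

/-! ### Characteristic functions of random sums -/

section CharacteristicFunctions

variable {Ω : Type*} [MeasurableSpace Ω] {P : Measure Ω} [IsProbabilityMeasure P]

lemma integrable_cexp_mul_I {a : Ω → ℝ} (ha : AEMeasurable a P) :
    Integrable (fun ω => Complex.exp (a ω * Complex.I)) P := by
  refine Integrable.of_bound ?_ 1 (ae_of_all _ fun ω => (Complex.norm_exp_ofReal_mul_I _).le)
  exact (Complex.measurable_exp.comp_aemeasurable
    ((Complex.measurable_ofReal.comp_aemeasurable ha).mul_const _)).aestronglyMeasurable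

lemma norm_cexp_sub_cexp_le (x y : ℝ) :
    ‖Complex.exp (x * Complex.I) - Complex.exp (y * Complex.I)‖ ≤ |x - y| := by
  have h : Complex.exp (x * Complex.I) - Complex.exp (y * Complex.I)
      = Complex.exp (y * Complex.I) * (Complex.exp (Complex.I * ((x - y : ℝ) : ℂ)) - 1) := by
    rw [mul_sub, mul_one, ← Complex.exp_add]
    congr 2
    push_cast
    ring
  rw [h, norm_mul, Complex.norm_exp_ofReal_mul_I, one_mul]
  exact Real.norm_exp_I_mul_ofReal_sub_one_le

lemma norm_integral_cexp_sub_le {a b : Ω → ℝ} (ha : AEMeasurable a P) (hb : AEMeasurable b P)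
    (hab : Integrable (fun ω => a ω - b ω) P) :
    ‖∫ ω, Complex.exp (a ω * Complex.I) ∂P - ∫ ω, Complex.exp (b ω * Complex.I) ∂P‖
      ≤ ∫ ω, |a ω - b ω| ∂P := by
  rw [← integral_sub (integrable_cexp_mul_I ha) (integrable_cexp_mul_I hb)]
  refine (norm_integral_le_integral_norm _).trans ?_
  exact integral_mono_of_nonneg (ae_of_all _ fun _ => norm_nonneg _) hab.abs
    (ae_of_all _ fun ω => norm_cexp_sub_cexp_le _ _)

lemma tendsto_integral_cexp_of_tendstoInDistribution {ι Ω' : Type*} [MeasurableSpace Ω']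
    {Q : Measure Ω'} [IsProbabilityMeasure Q] {l : Filter ι} {X : ι → Ω → ℝ} {Z : Ω' → ℝ}
    (h : TendstoInDistribution X l Z (fun _ => P) Q) :
    Tendsto (fun i => ∫ ω, Complex.exp (X i ω * Complex.I) ∂P) l
      (𝓝 (∫ ω, Complex.exp (Z ω * Complex.I) ∂Q)) := by
  have hexp : Measurable fun x : ℝ => Complex.exp (x * Complex.I) := by fun_prop
  have h1 := (ProbabilityMeasure.tendsto_iff_forall_integral_rclike_tendsto ℂ).1 h.tendsto
    (BoundedContinuousFunction.innerProbChar (1 : ℝ))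
  simp only [BoundedContinuousFunction.innerProbChar_apply, ProbabilityMeasure.coe_mk] at h1
  simp only [RCLike.inner_apply] at h1
  rw [integral_map h.aemeasurable_limit (by simpa using hexp.aestronglyMeasurable)] at h1
  refine (Tendsto.congr (fun i => ?_) h1).trans (le_of_eq ?_)
  · rw [integral_map (h.forall_aemeasurable i) (by simpa using hexp.aestronglyMeasurable)]
    simp
  · simp

/-- The central limit theorem along the continuous parameter `α`, for the first `⌊α / μ⌋₊`
summands, in terms of characteristic functions. -/
lemma tendsto_integral_cexp_sum_floor {X : ℕ → Ω → ℝ} (hXi : iIndepFun X P)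
    (hXd : ∀ k, IdentDistrib (X k) (X 0) P P) (hX2 : MemLp (X 0) 2 P) {μ : ℝ} (hμ : 0 < μ)
    (c : ℝ) :
    Tendsto (fun α : ℝ => ∫ ω, Complex.exp (((√α)⁻¹
        * (c * ∑ k ∈ Finset.range ⌊α / μ⌋₊, (X k ω - ∫ ω', X 0 ω' ∂P)) : ℝ) * Complex.I) ∂P) atTop
      (𝓝 (Complex.exp ((-(c ^ 2 * μ⁻¹ * Var[X 0; P] / 2) : ℝ)))) := by
  set v := Var[X 0; P].toNNReal with hv
  have hfloor : Tendsto (fun α : ℝ => ⌊α / μ⌋₊) atTop atTop :=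
    tendsto_nat_floor_atTop.comp (tendsto_id.atTop_div_const hμ)
  have hclt := tendstoInDistribution_inv_sqrt_mul_sum_sub (P := P) (P' := gaussianReal 0 v)
    (HasLaw.id (μ := gaussianReal 0 v)) hX2 hXi hXd
  have hclt2 : TendstoInDistribution (fun (α : ℝ) ω => (√(⌊α / μ⌋₊ : ℝ))⁻¹
      * (∑ k ∈ Finset.range ⌊α / μ⌋₊, X k ω - ⌊α / μ⌋₊ * ∫ ω', X 0 ω' ∂P)) atTop id
      (fun _ => P) (gaussianReal 0 v) :=
    ⟨fun α => hclt.forall_aemeasurable _, hclt.aemeasurable_limit, hclt.tendsto.comp hfloor⟩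
  -- the ratio of the normalizations `√⌊α / μ⌋₊` and `√α`, times `c`, enters by Slutsky's theorem
  have hratio : Tendsto (fun α : ℝ => c * √((⌊α / μ⌋₊ : ℝ) / α)) atTop (𝓝 (c * √μ⁻¹)) := by
    have h := tendsto_nat_floor_mul_div_atTop (R := ℝ) (inv_nonneg.2 hμ.le)
    simp_rw [← div_eq_inv_mul] at h
    exact ((Real.continuous_sqrt.tendsto _).comp h).const_mul c
  have hmeas : TendstoInMeasure P (fun (α : ℝ) (_ : Ω) => c * √((⌊α / μ⌋₊ : ℝ) / α)) atTop
      (fun _ => c * √μ⁻¹) := by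
    intro ε hε
    refine tendsto_const_nhds.congr' ?_
    filter_upwards [(tendsto_iff_edist_tendsto_0.1 hratio).eventually_lt_const hε] with α hα
    exact (measure_mono_null (t := ∅) (fun _ hx => (not_le.2 hα hx).elim) measure_empty).symm
  have hslutsky := hclt2.continuous_comp_prodMk_of_tendstoInMeasure_const
    (g := fun p : ℝ × ℝ => p.2 * p.1) (by fun_prop) hmeas (fun _ => aemeasurable_const)
  have h := tendsto_integral_cexp_of_tendstoInDistribution hslutsky
  have hlim : ∫ x, Complex.exp (((c * √μ⁻¹ * id x : ℝ) : ℂ) * Complex.I) ∂(gaussianReal 0 v)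
      = Complex.exp ((-(c ^ 2 * μ⁻¹ * Var[X 0; P] / 2) : ℝ)) := by
    have h1 := charFun_gaussianReal (μ := 0) (v := v) (c * √μ⁻¹)
    rw [charFun_apply_real] at h1
    have hvv : (v : ℝ) = Var[X 0; P] := Real.coe_toNNReal _ (variance_nonneg _ _)
    have hsq : (c * √μ⁻¹) ^ 2 = c ^ 2 * μ⁻¹ := by
      rw [mul_pow, Real.sq_sqrt (inv_nonneg.2 hμ.le)]
    calc _ = ∫ x : ℝ, Complex.exp (((c * √μ⁻¹ : ℝ) : ℂ) * x * Complex.I) ∂(gaussianReal 0 v) := by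
          simp only [id, Complex.ofReal_mul]
      _ = _ := by
          rw [h1, ← hsq, ← hvv]
          congr 1
          push_cast
          ring
  rw [hlim] at h
  refine h.congr' ?_
  filter_upwards [eventually_gt_atTop 0, hfloor.eventually_ge_atTop 1] with α hα hn
  have hn0 : (0 : ℝ) < ⌊α / μ⌋₊ := by exact_mod_cast hn
  refine integral_congr_ae (ae_of_all _ fun ω => ?_)
  dsimp only
  congr 3
  have hs : √(⌊α / μ⌋₊ : ℝ) ≠ 0 := (Real.sqrt_pos.2 hn0).ne'
  rw [Finset.sum_sub_distrib, Finset.sum_const, Finset.card_range, nsmul_eq_mul,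
    Real.sqrt_div hn0.le]
  field_simp

lemma indepFun_prodMk_of_indepFun {α β γ : Type*} [MeasurableSpace α] [MeasurableSpace β]
    [MeasurableSpace γ] {A : Ω → α} {B : Ω → β} {C : Ω → γ} (hA : Measurable A) (hB : Measurable B)
    (hC : Measurable C) (h1 : IndepFun A (fun ω => (B ω, C ω)) P) (h2 : IndepFun B C P) :
    IndepFun (fun ω => (A ω, B ω)) C P := by
  have hAB : IndepFun A B P := h1.comp measurable_id measurable_fst
  rw [indepFun_iff_map_prod_eq_prod_map_map hA.aemeasurable (by fun_prop)] at h1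
  rw [indepFun_iff_map_prod_eq_prod_map_map hB.aemeasurable hC.aemeasurable] at h2
  rw [indepFun_iff_map_prod_eq_prod_map_map hA.aemeasurable hB.aemeasurable] at hAB
  rw [indepFun_iff_map_prod_eq_prod_map_map (by fun_prop) hC.aemeasurable, hAB]
  have := Measure.isProbabilityMeasure_map (μ := P) hA.aemeasurable
  have := Measure.isProbabilityMeasure_map (μ := P) hB.aemeasurable
  have := Measure.isProbabilityMeasure_map (μ := P) hC.aemeasurable
  refine MeasurableEquiv.prodAssoc.map_measurableEquiv_injective ?_
  rw [Measure.prodAssoc_prod, ← h2, ← h1, Measure.map_map (by fun_prop) (by fun_prop)]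
  rfl

variable {Y : ℕ → Ω → ℝ} {μ : ℝ} {U : ℕ → Ω → ℝ}

lemma indepFun_min_of_indepFun {N : Ω → ℕ} (hN : Measurable N) (hUm : ∀ k, Measurable (U k))
    (hUi : iIndepFun U P) (hind : IndepFun (fun ω k => U k ω) N P) (K : ℕ) :
    IndepFun (fun ω => (min (N ω) (K + 1), fun k : Finset.range K => U k ω)) (U K) P := by
  have hpast : IndepFun (fun ω (k : Finset.range K) => U k ω) (U K) P :=
    (hUi.indepFun_finset (Finset.range K) {K} (by simp) hUm).comp measurable_id
      (measurable_pi_apply (⟨K, Finset.mem_singleton_self K⟩ : ({K} : Finset ℕ)))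
  refine indepFun_prodMk_of_indepFun
    ((measurable_from_top (f := fun m : ℕ => min m (K + 1))).comp hN)
    (measurable_pi_lambda _ fun k => hUm k) (hUm K) ?_ hpast
  refine hind.symm.comp (φ := fun m : ℕ => min m (K + 1))
    (ψ := fun u : ℕ → ℝ => ((fun k : Finset.range K => u k), u K)) measurable_from_top ?_
  fun_prop

end CharacteristicFunctions

/-! ### The central limit theorem for renewal-stopped sums of independent summands -/

section CompoundRenewal

variable {Ω : Type*} [MeasurableSpace Ω] {P : Measure Ω} {Y : ℕ → Ω → ℝ} {μ : ℝ} {U : ℕ → Ω → ℝ}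

lemma indepFun_ite_lt_of_indepFun {N : Ω → ℕ} (hind : IndepFun (fun ω k => U k ω) N P) (k : ℕ) :
    IndepFun (fun ω => if k < N ω then (1 : ℝ) else 0) (U k) P :=
  hind.symm.comp (φ := fun m : ℕ => if k < m then (1 : ℝ) else 0) (ψ := fun u : ℕ → ℝ => u k)
    measurable_from_top (measurable_pi_apply k)

namespace IsRenewalSteps

variable [IsProbabilityMeasure P]

lemma integrable_sum_range_renewalCount (hY : IsRenewalSteps P Y μ)
    (hUd : ∀ k, IdentDistrib (U k) (U 0) P P) (hU : Integrable (U 0) P) {α : ℝ} (hα : 0 ≤ α)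
    (hind : IndepFun (fun ω k => U k ω) (renewalCount Y α) P) :
    Integrable (fun ω => ∑ k ∈ Finset.range (renewalCount Y α ω), U k ω) P :=
  integrable_sum_range_random (measurable_renewalCount hY.measurable α)
    (hY.integrable_renewalCount hα) hUd hU (indepFun_ite_lt_of_indepFun hind)

lemma integral_sum_range_renewalCount (hY : IsRenewalSteps P Y μ)
    (hUd : ∀ k, IdentDistrib (U k) (U 0) P P) (hU : Integrable (U 0) P) {α : ℝ} (hα : 0 ≤ α)
    (hind : IndepFun (fun ω k => U k ω) (renewalCount Y α) P) :
    ∫ ω, ∑ k ∈ Finset.range (renewalCount Y α ω), U k ω ∂P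
      = (∫ ω, (renewalCount Y α ω : ℝ) ∂P) * ∫ ω, U 0 ω ∂P :=
  integral_sum_range_random (measurable_renewalCount hY.measurable α)
    (hY.integrable_renewalCount hα) hUd hU (indepFun_ite_lt_of_indepFun hind)

lemma tendsto_integral_abs_renewalCount_sub (hY : IsRenewalSteps P Y μ) :
    Tendsto (fun α => α⁻¹ * ∫ ω, |(renewalCount Y α ω : ℝ) - ⌊α / μ⌋₊| ∂P) atTop (𝓝 0) := by
  obtain ⟨C, -, hC⟩ := hY.exists_integral_renewalCount_le
  have hlim := hY.tendsto_integral_abs_firstPassage_sub.add tendsto_inv_atTop_zero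
  rw [add_zero] at hlim
  refine tendsto_of_tendsto_of_tendsto_of_le_of_le' tendsto_const_nhds hlim ?_ ?_
  · filter_upwards [eventually_ge_atTop 0] with α hα
    exact mul_nonneg (by positivity) (integral_nonneg fun _ => abs_nonneg _)
  filter_upwards [eventually_ge_atTop 0] with α hα
  have hi : Integrable (fun ω => |((renewalCount Y α ω + 1 : ℕ) : ℝ) - ⌊α / μ⌋₊|) P :=
    ((hC α hα).1.sub (integrable_const _)).abs
  have h : ∫ ω, |(renewalCount Y α ω : ℝ) - ⌊α / μ⌋₊| ∂P
      ≤ ∫ ω, |((renewalCount Y α ω + 1 : ℕ) : ℝ) - ⌊α / μ⌋₊| ∂P + 1 := by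
    calc _ ≤ ∫ ω, (|((renewalCount Y α ω + 1 : ℕ) : ℝ) - ⌊α / μ⌋₊| + 1) ∂P := by
          refine integral_mono_of_nonneg (ae_of_all _ fun _ => abs_nonneg _)
            (hi.add (integrable_const _)) (ae_of_all _ fun ω => ?_)
          dsimp only
          have h1 := abs_sub (((renewalCount Y α ω + 1 : ℕ) : ℝ) - ⌊α / μ⌋₊) 1
          rw [abs_one] at h1
          refine le_trans (le_of_eq ?_) h1
          congr 1
          push_cast
          ring
      _ = _ := by
          rw [integral_add hi (integrable_const _)]
          simp
  exact (mul_le_mul_of_nonneg_left h (by positivity)).trans (le_of_eq (by ring))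

/-- The fluctuations of the centred summands up to the renewal count are those up to the
deterministic time `α / μ`. -/
lemma tendsto_integral_abs_sum_sub (hY : IsRenewalSteps P Y μ) (hUm : ∀ k, Measurable (U k))
    (hUi : iIndepFun U P) (hUd : ∀ k, IdentDistrib (U k) (U 0) P P) (hU : MemLp (U 0) 2 P)
    (hind : ∀ α : ℝ, 0 ≤ α → IndepFun (fun ω k => U k ω) (renewalCount Y α) P) :
    (∀ α : ℝ, 0 ≤ α → Integrable (fun ω =>
      ∑ k ∈ Finset.range (renewalCount Y α ω), (U k ω - ∫ ω', U 0 ω' ∂P)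
        - ∑ k ∈ Finset.range ⌊α / μ⌋₊, (U k ω - ∫ ω', U 0 ω' ∂P)) P) ∧
    Tendsto (fun α => (√α)⁻¹ * ∫ ω,
      |∑ k ∈ Finset.range (renewalCount Y α ω), (U k ω - ∫ ω', U 0 ω' ∂P)
        - ∑ k ∈ Finset.range ⌊α / μ⌋₊, (U k ω - ∫ ω', U 0 ω' ∂P)| ∂P) atTop (𝓝 0) := by
  set m := ∫ ω', U 0 ω' ∂P with hm
  have hU2 : ∀ k, MemLp (U k) 2 P := fun k => (hUd k).memLp_iff.2 hU
  have key : ∀ α : ℝ, 0 ≤ α → _ := fun α hα => integral_sq_sum_range_random_sub_le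
    (measurable_renewalCount hY.measurable α) (hY.integrable_renewalCount hα)
    (ξ := fun k ω => U k ω - m) (s2 := Var[U 0; P])
    (fun k => (hU2 k).sub (memLp_const m))
    (fun k => by
      rw [integral_sub ((hU2 k).integrable (by norm_num)) (integrable_const _),
        (hUd k).integral_eq]
      simp [hm])
    (fun k => by
      have h := variance_eq_integral (hUm k).aemeasurable (μ := P)
      rw [(hUd k).integral_eq, (hUd k).variance_eq] at h
      exact h.symm)
    (fun K => (indepFun_min_of_indepFun (measurable_renewalCount hY.measurable α) hUm hUi
      (hind α hα) K).comp
      (φ := fun p : ℕ × (Finset.range K → ℝ) => (p.1, fun k => p.2 k - m)) (ψ := fun x => x - m)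
      (by fun_prop) (by fun_prop)) ⌊α / μ⌋₊
  refine ⟨fun α hα => (key α hα).1.integrable (by norm_num),
    tendsto_inv_sqrt_mul_integral_abs (fun α hα => (key α hα).1) ?_⟩
  have hlim := hY.tendsto_integral_abs_renewalCount_sub.const_mul (Var[U 0; P])
  rw [mul_zero] at hlim
  refine tendsto_of_tendsto_of_tendsto_of_le_of_le' tendsto_const_nhds hlim ?_ ?_
  · filter_upwards [eventually_ge_atTop 0] with α hα
    exact mul_nonneg (by positivity) (integral_nonneg fun _ => sq_nonneg _)
  · filter_upwards [eventually_ge_atTop 0] with α hα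
    refine (mul_le_mul_of_nonneg_left (key α hα).2 (by positivity)).trans (le_of_eq ?_)
    ring

/-- The characteristic function of a normalized sum of independent summands, stopped at an
independent renewal count, converges to that of a centred normal law. Its variance is the sum of a
contribution of the summands and one of the renewal count. -/
theorem tendsto_charFun_sum_range_renewalCount (hY : IsRenewalSteps P Y μ)
    (hUm : ∀ k, Measurable (U k)) (hUi : iIndepFun U P)
    (hUd : ∀ k, IdentDistrib (U k) (U 0) P P) (hU : MemLp (U 0) 2 P)
    (hind : ∀ α : ℝ, 0 ≤ α → IndepFun (fun ω k => U k ω) (renewalCount Y α) P) :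
    Tendsto (fun α : ℝ => ∫ ω, Complex.exp (((√α)⁻¹
        * (∑ k ∈ Finset.range (renewalCount Y α ω), U k ω
          - ∫ ω', ∑ k ∈ Finset.range (renewalCount Y α ω'), U k ω' ∂P) : ℝ) * Complex.I) ∂P) atTop
      (𝓝 (Complex.exp ((-((μ⁻¹ * Var[U 0; P]
        + μ⁻¹ ^ 3 * Var[Y 0; P] * (∫ ω, U 0 ω ∂P) ^ 2) / 2) : ℝ)))) := by
  have hμ := hY.mean_pos
  have hU1 : Integrable (U 0) P := hU.integrable (by norm_num)
  obtain ⟨hWi, hWlim⟩ := hY.tendsto_integral_abs_sum_sub hUm hUi hUd hU hind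
  set m := ∫ ω', U 0 ω' ∂P with hm
  have hNm := fun α => measurable_renewalCount hY.measurable α
  -- the centred count, and the centred sums with deterministic numbers of terms
  set A : ℝ → Ω → ℝ := fun α ω =>
    (renewalCount Y α ω : ℝ) - ∫ ω', (renewalCount Y α ω' : ℝ) ∂P with hA
  set W : ℝ → Ω → ℝ := fun α ω =>
    ∑ k ∈ Finset.range (renewalCount Y α ω), (U k ω - m) with hW
  set Q : ℝ → Ω → ℝ := fun α ω => ∑ k ∈ Finset.range ⌊α / μ⌋₊, (U k ω - m) with hQ
  set M : ℝ → Ω → ℝ := fun α ω => ∑ k ∈ Finset.range ⌊α / μ⌋₊, (Y k ω - μ) with hM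
  have hAm : ∀ α, Measurable (A α) := fun α =>
    ((measurable_from_top (f := fun n : ℕ => (n : ℝ))).comp (hNm α)).sub_const _
  have hQm : ∀ α, Measurable (Q α) := fun α =>
    Finset.measurable_fun_sum _ fun k _ => (hUm k).sub_const _
  have hMm : ∀ α, Measurable (M α) := fun α =>
    Finset.measurable_fun_sum _ fun k _ => (hY.measurable k).sub_const _
  have hMi : ∀ α, Integrable (M α) P := fun α =>
    integrable_finsetSum _ fun k _ => (hY.memLp_step_sub k).integrable (by norm_num)
  have hAi : ∀ α, 0 ≤ α → Integrable (A α) P := fun α hα =>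
    (hY.integrable_renewalCount hα).sub (integrable_const _)
  have hWm : ∀ α, 0 ≤ α → AEMeasurable (W α) P := fun α hα => by
    have h := (hWi α hα).aemeasurable.add (hQm α).aemeasurable
    refine h.congr (ae_of_all _ fun ω => ?_)
    simp [hW, hQ]
  -- replacing the random by the deterministic number of centred summands
  have h1 : Tendsto (fun α : ℝ =>
      ∫ ω, Complex.exp (((√α)⁻¹ * (W α ω + m * A α ω) : ℝ) * Complex.I) ∂P
      - ∫ ω, Complex.exp (((√α)⁻¹ * (Q α ω + m * A α ω) : ℝ) * Complex.I) ∂P) atTop (𝓝 0) := by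
    refine squeeze_zero_norm' ?_ hWlim
    filter_upwards [eventually_ge_atTop 0] with α hα
    have heq : ∀ ω, (√α)⁻¹ * (W α ω + m * A α ω) - (√α)⁻¹ * (Q α ω + m * A α ω)
        = (√α)⁻¹ * (W α ω - Q α ω) := fun ω => by ring
    refine (norm_integral_cexp_sub_le (a := fun ω => (√α)⁻¹ * (W α ω + m * A α ω))
      (b := fun ω => (√α)⁻¹ * (Q α ω + m * A α ω))
      (((hWm α hα).add ((hAm α).const_mul m).aemeasurable).const_mul _)
      (((hQm α).add ((hAm α).const_mul m)).const_mul _).aemeasurable ?_).trans (le_of_eq ?_)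
    · simp_rw [heq]
      exact (hWi α hα).const_mul _
    · simp_rw [heq, abs_mul, abs_of_nonneg (inv_nonneg.2 (Real.sqrt_nonneg α))]
      rw [integral_const_mul]
  -- replacing the centred count by the centred random walk of the steps
  have h2 : Tendsto (fun α : ℝ =>
      ∫ ω, Complex.exp (((√α)⁻¹ * (m * A α ω) : ℝ) * Complex.I) ∂P
      - ∫ ω, Complex.exp (((√α)⁻¹ * (-(m * μ⁻¹) * M α ω) : ℝ) * Complex.I) ∂P) atTop (𝓝 0) := by
    have hlim := hY.tendsto_integral_abs_renewalCount_add.const_mul |m|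
    rw [mul_zero] at hlim
    refine squeeze_zero_norm' ?_ hlim
    filter_upwards [eventually_ge_atTop 0] with α hα
    have heq : ∀ ω, (√α)⁻¹ * (m * A α ω) - (√α)⁻¹ * (-(m * μ⁻¹) * M α ω)
        = (√α)⁻¹ * m * (A α ω + μ⁻¹ * M α ω) := fun ω => by ring
    refine (norm_integral_cexp_sub_le (((hAm α).const_mul m).const_mul _).aemeasurable
      (((hMm α).const_mul _).const_mul _).aemeasurable ?_).trans (le_of_eq ?_)
    · simp_rw [heq]
      exact ((hAi α hα).add ((hMi α).const_mul _)).const_mul _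
    · simp_rw [heq, abs_mul ((√α)⁻¹ * m), abs_mul _ m,
        abs_of_nonneg (inv_nonneg.2 (Real.sqrt_nonneg α))]
      rw [integral_const_mul]
      ring
  have hQlim : Tendsto (fun α : ℝ => ∫ ω, Complex.exp (((√α)⁻¹ * Q α ω : ℝ) * Complex.I) ∂P) atTop
      (𝓝 (Complex.exp ((-(1 ^ 2 * μ⁻¹ * Var[U 0; P] / 2) : ℝ)))) := by
    simpa only [one_mul] using tendsto_integral_cexp_sum_floor hUi hUd hU hμ 1
  have hMlim : Tendsto (fun α : ℝ =>
      ∫ ω, Complex.exp (((√α)⁻¹ * (-(m * μ⁻¹) * M α ω) : ℝ) * Complex.I) ∂P) atTop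
      (𝓝 (Complex.exp ((-((-(m * μ⁻¹)) ^ 2 * μ⁻¹ * Var[Y 0; P] / 2) : ℝ)))) := by
    have h := tendsto_integral_cexp_sum_floor hY.indep hY.identDistrib hY.memLp hμ (-(m * μ⁻¹))
    rwa [hY.mean] at h
  have hAlim := h2.add hMlim
  simp only [sub_add_cancel, zero_add] at hAlim
  have hprod := hQlim.mul hAlim
  -- the summands are independent of the count, although not of the steps
  have hfac : ∀ α : ℝ, 0 ≤ α →
      ∫ ω, Complex.exp (((√α)⁻¹ * (Q α ω + m * A α ω) : ℝ) * Complex.I) ∂P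
      = (∫ ω, Complex.exp (((√α)⁻¹ * Q α ω : ℝ) * Complex.I) ∂P)
        * ∫ ω, Complex.exp (((√α)⁻¹ * (m * A α ω) : ℝ) * Complex.I) ∂P := by
    intro α hα
    have hi : IndepFun (fun ω => Complex.exp (((√α)⁻¹ * Q α ω : ℝ) * Complex.I))
        (fun ω => Complex.exp (((√α)⁻¹ * (m * A α ω) : ℝ) * Complex.I)) P :=
      (hind α hα).comp
        (φ := fun u : ℕ → ℝ => Complex.exp (((√α)⁻¹
          * ∑ k ∈ Finset.range ⌊α / μ⌋₊, (u k - m) : ℝ) * Complex.I))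
        (ψ := fun n : ℕ => Complex.exp (((√α)⁻¹
          * (m * ((n : ℝ) - ∫ ω', (renewalCount Y α ω' : ℝ) ∂P)) : ℝ) * Complex.I))
        (by fun_prop) measurable_from_top
    rw [← hi.integral_fun_mul_eq_mul_integral
      (integrable_cexp_mul_I ((hQm α).const_mul _).aemeasurable).aestronglyMeasurable
      (integrable_cexp_mul_I (((hAm α).const_mul m).const_mul _).aemeasurable).aestronglyMeasurable]
    refine integral_congr_ae (ae_of_all _ fun ω => ?_)
    dsimp only
    rw [← Complex.exp_add]
    congr 1
    push_cast
    ring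
  have hfin := h1.add hprod
  rw [zero_add, ← Complex.exp_add] at hfin
  have hval : ((-(1 ^ 2 * μ⁻¹ * Var[U 0; P] / 2) : ℝ) : ℂ)
      + ((-((-(m * μ⁻¹)) ^ 2 * μ⁻¹ * Var[Y 0; P] / 2) : ℝ) : ℂ)
      = ((-((μ⁻¹ * Var[U 0; P] + μ⁻¹ ^ 3 * Var[Y 0; P] * m ^ 2) / 2) : ℝ) : ℂ) := by
    rw [← Complex.ofReal_add]
    congr 1
    ring
  rw [hval] at hfin
  refine hfin.congr' ?_
  filter_upwards [eventually_ge_atTop 0] with α hα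
  rw [← hfac α hα, sub_add_cancel]
  refine integral_congr_ae (ae_of_all _ fun ω => ?_)
  dsimp only
  rw [hY.integral_sum_range_renewalCount hUd hU1 hα (hind α hα)]
  congr 4
  simp only [hW, hA, Finset.sum_sub_distrib, Finset.sum_const, Finset.card_range, nsmul_eq_mul]
  ring

end IsRenewalSteps

end CompoundRenewal

/-! ### Weak convergence in the plane -/

/-- Lévy's continuity theorem and the Cramér–Wold device for a bivariate normal limit: only the
characteristic functions of linear combinations are needed. -/
lemma tendstoInDistribution_prodMk_of_charFun {Ω : Type*} [MeasurableSpace Ω] {P : Measure Ω}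
    [IsProbabilityMeasure P] {A B : ℝ → Ω → ℝ} (hA : ∀ α, Measurable (A α))
    (hB : ∀ α, Measurable (B α)) {S : Matrix (Fin 2) (Fin 2) ℝ} (hS : S.PosSemidef)
    (h : ∀ u v : ℝ, Tendsto
      (fun α : ℝ => ∫ ω, Complex.exp ((u * A α ω + v * B α ω : ℝ) * Complex.I) ∂P) atTop
      (𝓝 (Complex.exp ((-((u ^ 2 * S 0 0 + u * v * (S 0 1 + S 1 0) + v ^ 2 * S 1 1) / 2) : ℝ))))) :
    TendstoInDistribution (fun (α : ℝ) ω => (A α ω, B α ω)) atTop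
      (fun x : EuclideanSpace ℝ (Fin 2) => (x 0, x 1)) (fun _ => P)
      (multivariateGaussian 0 S) := by
  have hX : ∀ α, Measurable fun ω => WithLp.toLp 2 ![A α ω, B α ω] := fun α => by
    refine (WithLp.measurable_toLp 2 _).comp (measurable_pi_lambda _ fun j => ?_)
    fin_cases j
    · exact hA α
    · exact hB α
  have hmain : TendstoInDistribution (fun (α : ℝ) ω => WithLp.toLp 2 ![A α ω, B α ω]) atTop
      (id : EuclideanSpace ℝ (Fin 2) → _) (fun _ => P) (multivariateGaussian 0 S) := by
    refine ⟨fun α => (hX α).aemeasurable, aemeasurable_id, ?_⟩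
    refine tendsto_of_seq_tendsto fun a ha => ?_
    refine ProbabilityMeasure.tendsto_of_tendsto_charFun fun s => ?_
    have hcf : ∀ α, charFun (P.map fun ω => WithLp.toLp 2 ![A α ω, B α ω]) s
        = ∫ ω, Complex.exp ((s 0 * A α ω + s 1 * B α ω : ℝ) * Complex.I) ∂P := by
      intro α
      rw [charFun_apply, integral_map (hX α).aemeasurable
        (Continuous.aestronglyMeasurable (by fun_prop))]
      refine integral_congr_ae (ae_of_all _ fun ω => ?_)
      simp [PiLp.inner_apply, Fin.sum_univ_two]
    have hlim : charFun (multivariateGaussian 0 S) s = Complex.exp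
        ((-((s 0 ^ 2 * S 0 0 + s 0 * s 1 * (S 0 1 + S 1 0) + s 1 ^ 2 * S 1 1) / 2) : ℝ)) := by
      rw [charFun_multivariateGaussian hS]
      congr 1
      simp only [inner_zero_right, Matrix.mulVec, dotProduct, Fin.sum_univ_two]
      push_cast
      ring
    simp only [ProbabilityMeasure.coe_mk, Measure.map_id, hlim]
    exact ((h (s 0) (s 1)).comp ha).congr fun n => (hcf (a n)).symm
  exact hmain.continuous_comp (g := fun x : EuclideanSpace ℝ (Fin 2) => (x 0, x 1)) (by fun_prop)

lemma hasGaussianLaw_prodMk_multivariateGaussian (S : Matrix (Fin 2) (Fin 2) ℝ) :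
    HasGaussianLaw (fun x : EuclideanSpace ℝ (Fin 2) => (x 0, x 1))
      (multivariateGaussian 0 S) :=
  (IsGaussian.hasGaussianLaw_id (μ := multivariateGaussian 0 S)).map_fun
    ((EuclideanSpace.proj (𝕜 := ℝ) (0 : Fin 2)).prod (EuclideanSpace.proj (1 : Fin 2)))

lemma integral_eval_multivariateGaussian_zero (S : Matrix (Fin 2) (Fin 2) ℝ) (j : Fin 2) :
    ∫ x : EuclideanSpace ℝ (Fin 2), x j ∂(multivariateGaussian 0 S) = 0 := by
  have h := (EuclideanSpace.proj j : EuclideanSpace ℝ (Fin 2) →L[ℝ] ℝ).integral_comp_comm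
    (IsGaussian.integrable_fun_id (μ := multivariateGaussian (0 : EuclideanSpace ℝ (Fin 2)) S))
  simpa using h

/-! ### Paid and outstanding claims -/

/-- The function of a claim that weights its size by `u` if it is paid by development year `t`,
and by `v` otherwise. -/
noncomputable def claimWeight (T t : ℕ) (u v : ℝ) (p : Year T × ℝ) : ℝ :=
  if (p.1 : ℕ) ≤ t then u * p.2 else v * p.2

lemma measurable_claimWeight (T t : ℕ) (u v : ℝ) : Measurable (claimWeight T t u v) :=
  measurable_from_prod_countable_right fun d => by
    unfold claimWeight
    dsimp only
    split_ifs <;> fun_prop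

namespace RenewalClaimsModel

variable {Ω : Type*} [MeasurableSpace Ω] {P : Measure Ω} {T : ℕ} {D : Year T → ℕ → Ω → Year T}
  {Z Y : Year T → ℕ → Ω → ℝ} {lam : Year T → ℝ}

lemma isRenewalSteps (model : RenewalClaimsModel P T D Z Y lam) (i : Year T) :
    IsRenewalSteps P (Y i) (1 / lam i) where
  measurable := model.measurable_Y i
  indep := model.steps_indep i
  identDistrib k := model.steps_identDistrib i k 0
  nonneg := model.steps_nonneg i
  memLp := model.steps_sq i 0
  mean := model.steps_mean i 0
  mean_pos := one_div_pos.2 (model.lam_pos i)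

lemma memLp_weight (model : RenewalClaimsModel P T D Z Y lam) (i : Year T) (t : ℕ) (u v : ℝ) :
    MemLp (fun ω => claimWeight T t u v (D i 0 ω, Z i 0 ω)) 2 P := by
  refine ((model.claims_sq i 0).const_mul (|u| + |v|)).mono
    ((measurable_claimWeight T t u v).comp
      ((model.measurable_D i 0).prodMk (model.measurable_Z i 0))).aestronglyMeasurable
    (ae_of_all _ fun ω => ?_)
  simp only [claimWeight, Real.norm_eq_abs, abs_mul]
  rw [abs_of_nonneg (by positivity : 0 ≤ |u| + |v|)]
  split_ifs <;> rw [abs_mul] <;> gcongr <;> simp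

lemma measurable_sum_weight (model : RenewalClaimsModel P T D Z Y lam) (i : Year T) (t : ℕ)
    (u v α : ℝ) :
    Measurable (fun ω => ∑ k ∈ Finset.range (renewalCount (Y i) α ω),
      claimWeight T t u v (D i k ω, Z i k ω)) := by
  have h : Measurable fun p : ℕ × Ω => ∑ k ∈ Finset.range p.1,
      claimWeight T t u v (D i k p.2, Z i k p.2) :=
    measurable_from_prod_countable_right fun n => Finset.measurable_fun_sum (Finset.range n)
      fun k _ => (measurable_claimWeight T t u v).comp
        ((model.measurable_D i k).prodMk (model.measurable_Z i k))
  exact h.comp ((measurable_renewalCount (model.measurable_Y i) α).prodMk measurable_id)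

variable [IsProbabilityMeasure P]

lemma tendsto_charFun_weight (model : RenewalClaimsModel P T D Z Y lam) (i : Year T) (t : ℕ)
    (u v : ℝ) :
    Tendsto (fun α : ℝ => ∫ ω, Complex.exp (((√α)⁻¹
        * (∑ k ∈ Finset.range (renewalCount (Y i) α ω), claimWeight T t u v (D i k ω, Z i k ω)
          - ∫ ω', ∑ k ∈ Finset.range (renewalCount (Y i) α ω'),
            claimWeight T t u v (D i k ω', Z i k ω') ∂P) : ℝ) * Complex.I) ∂P) atTop
      (𝓝 (Complex.exp ((-((lam i * Var[fun ω => claimWeight T t u v (D i 0 ω, Z i 0 ω); P]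
        + lam i ^ 3 * Var[Y i 0; P]
          * (∫ ω, claimWeight T t u v (D i 0 ω, Z i 0 ω) ∂P) ^ 2) / 2) : ℝ)))) := by
  have h := (model.isRenewalSteps i).tendsto_charFun_sum_range_renewalCount
    (U := fun k ω => claimWeight T t u v (D i k ω, Z i k ω))
    (fun k => (measurable_claimWeight T t u v).comp
      ((model.measurable_D i k).prodMk (model.measurable_Z i k)))
    ((model.claims_indep i).comp (fun _ => claimWeight T t u v)
      fun _ => measurable_claimWeight T t u v)
    (fun k => (model.claims_identDistrib i k i 0).comp (measurable_claimWeight T t u v))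
    (model.memLp_weight i t u v)
    (fun α hα => (model.count_indep_claims i α hα).comp
      (φ := fun (p : ℕ → Year T × ℝ) k => claimWeight T t u v (p k))
      (measurable_pi_lambda _ fun k =>
        (measurable_claimWeight T t u v).comp (measurable_pi_apply k))
      measurable_id)
  simpa only [one_div, inv_inv] using h

lemma integrable_sum_weight (model : RenewalClaimsModel P T D Z Y lam) (i : Year T) (t : ℕ)
    (u v : ℝ) {α : ℝ} (hα : 0 ≤ α) :
    Integrable (fun ω => ∑ k ∈ Finset.range (renewalCount (Y i) α ω),
      claimWeight T t u v (D i k ω, Z i k ω)) P :=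
  (model.isRenewalSteps i).integrable_sum_range_renewalCount
    (U := fun k ω => claimWeight T t u v (D i k ω, Z i k ω))
    (fun k => (model.claims_identDistrib i k i 0).comp (measurable_claimWeight T t u v))
    ((model.memLp_weight i t u v).integrable (by norm_num)) hα
    ((model.count_indep_claims i α hα).comp
      (φ := fun (p : ℕ → Year T × ℝ) k => claimWeight T t u v (p k))
      (measurable_pi_lambda _ fun k =>
        (measurable_claimWeight T t u v).comp (measurable_pi_apply k))
      measurable_id)

end RenewalClaimsModel

theorem mainTheorem6 {Ω : Type*} [MeasurableSpace Ω] (P : Measure Ω) [IsProbabilityMeasure P]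
    (T : ℕ) (D : Year T → ℕ → Ω → Year T) (Z Y : Year T → ℕ → Ω → ℝ) (lam : Year T → ℝ)
    (model : RenewalClaimsModel P T D Z Y lam)
    (i : Year T) (t : ℕ) (ht : t = T - (i : ℕ) + 1)
    -- paid-to-date amount, amount paid at the end of the development, outstanding amount
    (C CT R : ℝ → Ω → ℝ)
    (hC : ∀ α ω, C α ω = cumulativeClaims (D i) (Z i) (Y i) α t ω)
    (hCT : ∀ α ω, CT α ω = cumulativeClaims (D i) (Z i) (Y i) α T ω)
    (hR : ∀ α ω, R α ω = CT α ω - C α ω)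
    (Hα Fα : ℝ → Ω → ℝ)
    (hHα : ∀ α ω, Hα α ω = α ^ (-(1 / 2) : ℝ) * (C α ω - ∫ ω', C α ω' ∂P))
    (hFα : ∀ α ω, Fα α ω = α ^ (-(1 / 2) : ℝ) * (R α ω - ∫ ω', R α ω' ∂P)) :
    (∀ α : ℝ, 0 ≤ α → Integrable (C α) P ∧ Integrable (CT α) P) ∧
    ∃ (Ω' : Type) (_ : MeasurableSpace Ω') (Q : Measure Ω') (_ : IsProbabilityMeasure Q)
      (H F : Ω' → ℝ),
      HasGaussianLaw (fun ω => (H ω, F ω)) Q ∧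
      ∫ ω, H ω ∂Q = 0 ∧ ∫ ω, F ω ∂Q = 0 ∧
      Var[H; Q] =
        lam i * (∫ ω, (if (D i 0 ω : ℕ) ≤ t then Z i 0 ω ^ 2 else 0) ∂P)
          + lam i * (lam i ^ 2 * Var[Y i 0; P] - 1)
            * (∫ ω, (if (D i 0 ω : ℕ) ≤ t then Z i 0 ω else 0) ∂P) ^ 2 ∧
      Var[F; Q] =
        lam i * (∫ ω, (if t < (D i 0 ω : ℕ) then Z i 0 ω ^ 2 else 0) ∂P)
          + lam i * (lam i ^ 2 * Var[Y i 0; P] - 1)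
            * (∫ ω, (if t < (D i 0 ω : ℕ) then Z i 0 ω else 0) ∂P) ^ 2 ∧
      cov[H, F; Q] =
        lam i * (lam i ^ 2 * Var[Y i 0; P] - 1)
          * (∫ ω, (if (D i 0 ω : ℕ) ≤ t then Z i 0 ω else 0) ∂P)
          * (∫ ω, (if t < (D i 0 ω : ℕ) then Z i 0 ω else 0) ∂P) ∧
      TendstoInDistribution (fun (α : ℝ) ω => (Hα α ω, Fα α ω)) atTop
        (fun ω => (H ω, F ω)) (fun _ => P) Q := by
  let W : ℝ → ℝ → ℝ → Ω → ℝ := fun u v α ω => ∑ k ∈ Finset.range (renewalCount (Y i) α ω),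
    claimWeight T t u v (D i k ω, Z i k ω)
  have hWlin : ∀ u v α ω, W u v α ω = u * W 1 0 α ω + v * W 0 1 α ω := by
    intro u v α ω
    simp only [W, Finset.mul_sum, ← Finset.sum_add_distrib, claimWeight]
    refine Finset.sum_congr rfl fun k _ => ?_
    split_ifs <;> ring
  have hCW : C = W 1 0 := by
    funext α ω
    simp only [hC, cumulativeClaims, W, claimWeight, one_mul, zero_mul]
  have hCTW : CT = W 1 1 := by
    funext α ω
    simp only [hCT, cumulativeClaims, W, claimWeight, one_mul, ite_self]
    exact Finset.sum_congr rfl fun k _ => if_pos (D i k ω).2.2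
  have hRW : R = W 0 1 := by
    funext α ω
    rw [hR, hCW, hCTW, hWlin 1 1]
    ring
  have hWi : ∀ u v α, 0 ≤ α → Integrable (W u v α) P := fun u v α hα =>
    model.integrable_sum_weight i t u v hα
  have hWm : ∀ u v α, Measurable (W u v α) := fun u v α => model.measurable_sum_weight i t u v α
  subst hCW hCTW hRW
  refine ⟨fun α hα => ⟨hWi 1 0 α hα, hWi 1 1 α hα⟩, ?_⟩
  set a := ∫ ω, (if (D i 0 ω : ℕ) ≤ t then Z i 0 ω else 0) ∂P with ha
  set b := ∫ ω, (if t < (D i 0 ω : ℕ) then Z i 0 ω else 0) ∂P with hb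
  set p := ∫ ω, (if (D i 0 ω : ℕ) ≤ t then Z i 0 ω ^ 2 else 0) ∂P with hp
  set q := ∫ ω, (if t < (D i 0 ω : ℕ) then Z i 0 ω ^ 2 else 0) ∂P with hq
  set V := Var[Y i 0; P] with hV
  have hDm : MeasurableSet {ω | (D i 0 ω : ℕ) ≤ t} :=
    model.measurable_D i 0 (measurableSet_le measurable_subtype_coe measurable_const)
  have hDm' : MeasurableSet {ω | t < (D i 0 ω : ℕ)} :=
    model.measurable_D i 0 (measurableSet_lt measurable_const measurable_subtype_coe)
  have hZ1 : Integrable (Z i 0) P := (model.claims_sq i 0).integrable (by norm_num)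
  have hZ2 : Integrable (fun ω => Z i 0 ω ^ 2) P := (model.claims_sq i 0).integrable_sq
  have hite : ∀ {f : Ω → ℝ} {s : Ω → Prop} [DecidablePred s], MeasurableSet {ω | s ω} →
      Integrable f P → Integrable (fun ω => if s ω then f ω else 0) P := by
    intro f s _ hs hf
    refine (hf.indicator hs).congr (ae_of_all _ fun ω => ?_)
    simp [Set.indicator_apply]
  have hmean : ∀ u v, ∫ ω, claimWeight T t u v (D i 0 ω, Z i 0 ω) ∂P = u * a + v * b := by
    intro u v
    rw [ha, hb, ← integral_const_mul, ← integral_const_mul,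
      ← integral_add ((hite hDm hZ1).const_mul u) ((hite hDm' hZ1).const_mul v)]
    refine integral_congr_ae (ae_of_all _ fun ω => ?_)
    simp only [claimWeight]
    split_ifs <;> first | omega | ring
  have hsq : ∀ u v, ∫ ω, claimWeight T t u v (D i 0 ω, Z i 0 ω) ^ 2 ∂P = u ^ 2 * p + v ^ 2 * q := by
    intro u v
    rw [hp, hq, ← integral_const_mul, ← integral_const_mul,
      ← integral_add ((hite hDm hZ2).const_mul _) ((hite hDm' hZ2).const_mul _)]
    refine integral_congr_ae (ae_of_all _ fun ω => ?_)
    simp only [claimWeight]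
    split_ifs <;> first | omega | ring
  have hvar : ∀ u v, Var[fun ω => claimWeight T t u v (D i 0 ω, Z i 0 ω); P]
      = u ^ 2 * p + v ^ 2 * q - (u * a + v * b) ^ 2 := by
    intro u v
    rw [variance_eq_sub (model.memLp_weight i t u v), hmean, ← hsq]
    rfl
  set κ := lam i * (lam i ^ 2 * V - 1) with hκ
  set S : Matrix (Fin 2) (Fin 2) ℝ :=
    !![lam i * p + κ * a ^ 2, κ * a * b; κ * a * b, lam i * q + κ * b ^ 2] with hSdef
  -- the quadratic form of `S` is the limiting variance of a linear combination
  have hform : ∀ u v : ℝ, u ^ 2 * S 0 0 + u * v * (S 0 1 + S 1 0) + v ^ 2 * S 1 1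
      = lam i * (u ^ 2 * p + v ^ 2 * q - (u * a + v * b) ^ 2)
        + lam i ^ 3 * V * (u * a + v * b) ^ 2 := by
    intro u v
    simp only [hSdef, Matrix.of_apply, Matrix.cons_val', Matrix.cons_val_zero, Matrix.cons_val_one,
      Matrix.cons_val_fin_one, hκ]
    ring
  have hS : S.PosSemidef := by
    refine Matrix.PosSemidef.of_dotProduct_mulVec_nonneg ?_ fun x => ?_
    · ext j k
      fin_cases j <;> fin_cases k <;> simp [hSdef]
    · have hx : star x ⬝ᵥ S.mulVec x
          = x 0 ^ 2 * S 0 0 + x 0 * x 1 * (S 0 1 + S 1 0) + x 1 ^ 2 * S 1 1 := by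
        simp only [Matrix.mulVec, dotProduct, Fin.sum_univ_two, star_trivial]
        ring
      rw [hx, hform, ← hvar]
      have h1 := variance_nonneg (fun ω => claimWeight T t (x 0) (x 1) (D i 0 ω, Z i 0 ω)) P
      have h2 : 0 ≤ V := variance_nonneg _ _
      have h3 := model.lam_pos i
      positivity
  refine ⟨EuclideanSpace ℝ (Fin 2), inferInstance, multivariateGaussian 0 S, inferInstance,
    fun x => x 0, fun x => x 1, hasGaussianLaw_prodMk_multivariateGaussian S,
    integral_eval_multivariateGaussian_zero S 0, integral_eval_multivariateGaussian_zero S 1,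
    ?_, ?_, ?_, ?_⟩
  · rw [variance_eval_multivariateGaussian hS]
    simp [hSdef]
  · rw [variance_eval_multivariateGaussian hS]
    simp [hSdef]
  · rw [covariance_eval_multivariateGaussian hS]
    simp [hSdef]
  · have hHm : ∀ α, Measurable (Hα α) := fun α => by
      rw [show Hα α = _ from funext (hHα α)]
      exact ((hWm 1 0 α).sub_const _).const_mul _
    have hFm : ∀ α, Measurable (Fα α) := fun α => by
      rw [show Fα α = _ from funext (hFα α)]
      exact ((hWm 0 1 α).sub_const _).const_mul _
    refine tendstoInDistribution_prodMk_of_charFun hHm hFm hS fun u v => ?_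
    have h := model.tendsto_charFun_weight i t u v
    rw [hvar, hmean, ← hform] at h
    refine h.congr' ?_
    filter_upwards [eventually_ge_atTop 0] with α hα
    refine integral_congr_ae (ae_of_all _ fun ω => ?_)
    dsimp only
    have hint : ∫ ω', W u v α ω' ∂P = u * ∫ ω', W 1 0 α ω' ∂P + v * ∫ ω', W 0 1 α ω' ∂P := by
      rw [← integral_const_mul, ← integral_const_mul,
        ← integral_add ((hWi 1 0 α hα).const_mul u) ((hWi 0 1 α hα).const_mul v)]
      exact integral_congr_ae (ae_of_all _ fun ω => hWlin u v α ω)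
    have hpow : α ^ (-(1 / 2) : ℝ) = (√α)⁻¹ := by
      rw [Real.rpow_neg hα, ← Real.sqrt_eq_rpow]
    congr 3
    change (√α)⁻¹ * (W u v α ω - ∫ ω', W u v α ω' ∂P) = _
    rw [hint, hWlin u v, hHα, hFα, hpow]
    ring
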